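/- **Setting.** Let $T>0$. Let $X=(X_t)_{t\in[0,T]}$ be an (almost surely) continuous centered Gaussian process with $X_0=0$ which is a *regular invertible Gaussian Volterra process*, that is: 1. there are a continuous non-decreasing $m:[0,T]\to\mathbb R_+$ and a Volterra kernel $K\in L^2([0,T]^2,\mathrm dm\times \mathrm dm)$ ($K(t,s)=0$ for $t<s$), with $K(t,\cdot)\in L^2(\mathrm dm)$ for every $t$, such that $\mathbb E[X_tX_s]=\int_0^{t\wedge s}K(t,u)K(s,u)\,\mathrm dm(u)$; moreover $K$ is non-decreasing in its first variable, $\partial K/\partial t$ exists and is continuous on $\{0<s<t\le T\}$, $t\mapsto K(t,s)$ is continuous on $[s,T]$ for each $s\in(0,T]$, and $s\mapsto K(s,s)$ is continuously differentiable on $(0,T]$; 2. for every $t\in[0,T]$ the equation $g(s)K(T,s)+\int_s^T[g(u)-g(s)]\frac{\partial K}{\partial t}(u,s)\,\mathrm du=1_{[0,t)}(s)$ (for $\mathrm dm$-almost every $s$) has a solution $g$. Put $q^2(t)=\int_0^tK(s,s)^2\,\mathrm dm(s)$, $q^2(s,t)=q^2(t)-q^2(s)$, $q(s,t)=\sqrt{q^2(s,t)}$,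 and assume that $q^2(s,t)>0$ for all $0\le s<t\le T$. Let $\mu:[0,T]\to\mathbb R$ be continuous and of bounded variation, let $S_0>0$, and let $$S_t=S_0\exp\{\mu(t)-\mu(0)-\tfrac12q^2(t)+X_t\},\qquad t\in[0,T],$$ be the discounted asset price (the solution of $\mathrm dS_t/S_t=\mathrm d\mu(t)+\mathrm dX_t$). Let $\phi$ be the standard normal density. Let $f(S_T)$ be a European claim whose payoff $f$ is continuous at Lebesgue-almost every $x>0$ (for example continuous, convex, concave or piecewise continuous on $(0,\infty)$) and such that $z\mapsto f(xe^{-\frac12q^2(0,T)+q(0,T)z})\phi(z)$ is integrable for every $x>0$. For $0\le t<T$, the *forward integral* $\int_0^tY\,\mathrm dS$ is the limit in probability of $\sum_{t_k\le t}Y_{t_{k-1}}(S_{t_k}-S_{t_{k-1}})$ along every sequence of partitions $0=t_0<t_1<\dots<t_n=T$ whose mesh tends to $0$, and $\int_0^TY\,\mathrm dS$ is the almost sure limit of $\int_0^tY\,\mathrm dS$ as $t\uparrow T$. **Proposition 3.1 (Robust Hedging).** The process $X$ has quadratic variation $q^2$: $\sum_{t_k\le t}(X_{t_k}-X_{t_{k-1}})^2\to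 q^2(t)$ in probability for every $t\in[0,T]$ along every sequence of partitions whose mesh tends to $0$. The function $$v(t,x)=\int_{-\infty}^\infty f\big(xe^{-\frac12q^2(t,T)+q(t,T)z}\big)\phi(z)\,\mathrm dz$$ is well defined, with an absolutely convergent integral, for $t\in[0,T]$, $x>0$, and is differentiable in $x$ for $t\in[0,T)$, $x>0$. The claim $f(S_T)$ has a Markovian replicating strategy given by the delta-hedge $$\pi_t=\frac{\partial v}{\partial x}(t,S_t),\qquad t\in[0,T),$$ and $V_t=v(t,S_t)$ is its value at time $t\in[0,T]$: $V_0$ is almost surely constant, $V_t=V_0+\int_0^t\pi_s\,\mathrm dS_s$ for all $t\in[0,T]$ (forward integral), and $V_T=f(S_T)$ almost surely. Moreover, the integral is also a pathwise one: almost surely, along every sequence of partitions with mesh tending to $0$ along which the quadratic variation sums of the path of $X$ converge to $q^2(t)$ for all $t\in[0,T]$, one has $\sum_{t_k\le t}\pi_{t_{k-1}}(S_{t_k}-S_{t_{k-1}})\to V_t-V_0$ for all $t\in[0,T)$. -/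

import Mathlib

open MeasureTheory ProbabilityTheory Filter Set
open scoped Topology

namespace GaussianHedging

noncomputable section

/-! ### Regular invertible Gaussian Volterra processes -/

/-- The partial derivative `∂K/∂t (t, s)` of a kernel on `[0,T]²` (one-sided at `t = T`). -/
def kernelDeriv (T : ℝ) (K : ℝ → ℝ → ℝ) (t s : ℝ) : ℝ :=
  derivWithin (fun r => K r s) (Icc 0 T) t

/-- Regularity and invertibility of a Volterra kernel `K` on `[0,T]²` with respect to the measure
`dm` of an increasing function `m`. Since `m` is continuous, `dm` does not charge points, and all
integrals are taken over half-open intervals `(0, t]`. Only the values of `m` on `[0,T]` and those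
of `K` on `[0,T] × (0,T]` matter. -/
structure IsRegularInvertibleKernel (T : ℝ) (K : ℝ → ℝ → ℝ) (m : StieltjesFunction ℝ) : Prop where
  m_nonneg : ∀ t ∈ Icc 0 T, 0 ≤ m t
  m_continuous : ContinuousOn m (Icc 0 T)
  /-- `K` is a Volterra kernel. -/
  volterra : ∀ s ∈ Ioc 0 T, ∀ t ∈ Icc 0 T, t < s → K t s = 0
  /-- `K ∈ L²([0,T]², dm × dm)`. -/
  memLp : MemLp (fun p : ℝ × ℝ => K p.1 p.2) 2
    ((m.measure.restrict (Ioc 0 T)).prod (m.measure.restrict (Ioc 0 T)))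
  /-- Every section `K(t, ·)` is in `L²(dm)`, so that the covariance integrals exist. -/
  memLp_section : ∀ t ∈ Icc 0 T, MemLp (K t) 2 (m.measure.restrict (Ioc 0 t))
  monotone : ∀ s ∈ Ioc 0 T, MonotoneOn (fun t => K t s) (Icc 0 T)
  /-- Off the diagonal `K` has a partial derivative in the first variable ... -/
  differentiable : ∀ s t, 0 < s → s < t → t ≤ T →
    DifferentiableWithinAt ℝ (fun r => K r s) (Icc 0 T) t
  /-- ... which is continuous there. -/
  continuous_deriv : ContinuousOn (fun p : ℝ × ℝ => kernelDeriv T K p.1 p.2)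
    {p : ℝ × ℝ | 0 < p.2 ∧ p.2 < p.1 ∧ p.1 ≤ T}
  /-- `K(·, s)` is continuous up to the diagonal. -/
  continuous_section : ∀ s ∈ Ioc 0 T, ContinuousOn (fun t => K t s) (Icc s T)
  /-- The diagonal `s ↦ K(s, s)` is continuously differentiable. -/
  diagonal : ContDiffOn ℝ 1 (fun s => K s s) (Ioc 0 T)
  /-- For every `t` the equation `K*[g] = 1_[0,t)` has a solution `g`, where
  `K*[g](s) = g(s) K(T,s) + ∫_s^T (g(u) - g(s)) ∂K/∂t(u,s) du`. -/
  invertible : ∀ t ∈ Icc 0 T, ∃ g : ℝ → ℝ, ∀ᵐ s ∂(m.measure.restrict (Ioc 0 T)),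
    IntegrableOn (fun u => (g u - g s) * kernelDeriv T K u s) (Ioc s T) ∧
    g s * K T s + ∫ u in Ioc s T, (g u - g s) * kernelDeriv T K u s
      = (Ico 0 t).indicator (fun _ => (1 : ℝ)) s

/-- `X` is a continuous centered Gaussian process on `[0,T]`, started at `0`, and it is a regular
invertible Gaussian Volterra process with kernel `K` and increasing function `m`. -/
structure IsRegularInvertibleGaussianVolterra {Ω : Type*} [MeasurableSpace Ω] (P : Measure Ω)
    (T : ℝ) (X : ℝ → Ω → ℝ) (K : ℝ → ℝ → ℝ) (m : StieltjesFunction ℝ) : Prop where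
  gaussian : IsGaussianProcess (fun t : Icc (0 : ℝ) T => X t) P
  centered : ∀ t ∈ Icc 0 T, ∫ ω, X t ω ∂P = 0
  continuous : ∀ᵐ ω ∂P, ContinuousOn (fun t => X t ω) (Icc 0 T)
  start : ∀ᵐ ω ∂P, X 0 ω = 0
  kernel : IsRegularInvertibleKernel T K m
  covariance : ∀ t ∈ Icc 0 T, ∀ s ∈ Icc 0 T,
    ∫ ω, X t ω * X s ω ∂P = ∫ u in Ioc 0 (min t s), K t u * K s u ∂m.measure

/-! ### The pricing model -/

/-- `q²(t) = ∫_0^t K(s,s)² dm(s)`. -/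
def qSq (K : ℝ → ℝ → ℝ) (m : StieltjesFunction ℝ) (t : ℝ) : ℝ :=
  ∫ s in Ioc 0 t, K s s ^ 2 ∂m.measure

/-- `q²(s,t) = q²(t) - q²(s)`. -/
def qSqBetween (K : ℝ → ℝ → ℝ) (m : StieltjesFunction ℝ) (s t : ℝ) : ℝ :=
  qSq K m t - qSq K m s

/-- `q(s,t)`, the square root of `q²(s,t)`. -/
def qBetween (K : ℝ → ℝ → ℝ) (m : StieltjesFunction ℝ) (s t : ℝ) : ℝ :=
  Real.sqrt (qSqBetween K m s t)

/-- The discounted price `S_t = S_0 exp(μ(t) - μ(0) - q²(t)/2 + X_t)`, the solution of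
`dS/S = dμ + dX` with initial value `s₀`, where `b` stands for `μ`. -/
def assetPrice {Ω : Type*} (s₀ : ℝ) (b : ℝ → ℝ) (X : ℝ → Ω → ℝ) (K : ℝ → ℝ → ℝ)
    (m : StieltjesFunction ℝ) (t : ℝ) (ω : Ω) : ℝ :=
  s₀ * Real.exp (b t - b 0 - qSq K m t / 2 + X t ω)

/-- The integrand `f(x exp(-q²(t,T)/2 + q(t,T) z)) φ(z)`, with `φ` the standard normal density. -/
def valueIntegrand (T : ℝ) (K : ℝ → ℝ → ℝ) (m : StieltjesFunction ℝ) (f : ℝ → ℝ)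
    (t x z : ℝ) : ℝ :=
  f (x * Real.exp (-(qSqBetween K m t T) / 2 + qBetween K m t T * z)) * gaussianPDFReal 0 1 z

/-- `v(t,x) = ∫ f(x exp(-q²(t,T)/2 + q(t,T) z)) φ(z) dz`. -/
def value (T : ℝ) (K : ℝ → ℝ → ℝ) (m : StieltjesFunction ℝ) (f : ℝ → ℝ) (t x : ℝ) : ℝ :=
  ∫ z, valueIntegrand T K m f t x z

/-- The delta `∂v/∂x (t,x)`. -/
def delta (T : ℝ) (K : ℝ → ℝ → ℝ) (m : StieltjesFunction ℝ) (f : ℝ → ℝ) (t x : ℝ) : ℝ :=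
  deriv (fun y => value T K m f t y) x

/-! ### Partitions, quadratic variation and forward integrals -/

/-- A partition `0 = t_0 < t_1 < ⋯ < t_n = T` of `[0,T]`. -/
structure TimePartition (T : ℝ) where
  n : ℕ
  pt : ℕ → ℝ
  pt_zero : pt 0 = 0
  pt_last : pt n = T
  pt_lt : ∀ k < n, pt k < pt (k + 1)

/-- `max_k |t_k - t_{k-1}| → 0` along a sequence of partitions. -/
def MeshTendsToZero {T : ℝ} (p : ℕ → TimePartition T) : Prop :=
  ∀ ε > 0, ∀ᶠ j in atTop, ∀ k < (p j).n, (p j).pt (k + 1) - (p j).pt k < ε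

/-- `∑_{t_k ≤ t} (x(t_k) - x(t_{k-1}))²`. -/
def qvSum {T : ℝ} (p : TimePartition T) (x : ℝ → ℝ) (t : ℝ) : ℝ :=
  ∑ k ∈ (Finset.range p.n).filter (fun k => p.pt (k + 1) ≤ t),
    (x (p.pt (k + 1)) - x (p.pt k)) ^ 2

/-- The forward Riemann sum `∑_{t_k ≤ t} y(t_{k-1}) (x(t_k) - x(t_{k-1}))`. -/
def forwardSum {T : ℝ} (p : TimePartition T) (y x : ℝ → ℝ) (t : ℝ) : ℝ :=
  ∑ k ∈ (Finset.range p.n).filter (fun k => p.pt (k + 1) ≤ t),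
    y (p.pt k) * (x (p.pt (k + 1)) - x (p.pt k))

/-- `X` has quadratic variation `q` on `[0,T]`, as a limit in probability along all sequences of
partitions whose mesh tends to `0`. -/
def HasQuadraticVariation {Ω : Type*} [MeasurableSpace Ω] (P : Measure Ω) (T : ℝ)
    (X : ℝ → Ω → ℝ) (q : ℝ → ℝ) : Prop :=
  ∀ p : ℕ → TimePartition T, MeshTendsToZero p → ∀ t ∈ Icc 0 T,
    TendstoInMeasure P (fun j ω => qvSum (p j) (fun s => X s ω) t) atTop (fun _ => q t)

/-- The path `x` has pathwise quadratic variation `q` on `[0,T]` along the sequence `p`. -/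
def HasPathwiseQuadraticVariation {T : ℝ} (p : ℕ → TimePartition T) (x q : ℝ → ℝ) : Prop :=
  ∀ t ∈ Icc 0 T, Tendsto (fun j => qvSum (p j) x t) atTop (𝓝 (q t))

/-- `I_t = ∫_0^t Y dS` for `t ∈ [0,T]` in the forward sense: for `t < T` the integral is the limit
in probability of the forward Riemann sums along all sequences of partitions whose mesh tends to
`0`, and `∫_0^T Y dS` is the almost sure limit of `∫_0^t Y dS` as `t ↑ T`. -/
structure IsForwardIntegral {Ω : Type*} [MeasurableSpace Ω] (P : Measure Ω) (T : ℝ)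
    (Y S I : ℝ → Ω → ℝ) : Prop where
  tendsto_sum : ∀ p : ℕ → TimePartition T, MeshTendsToZero p → ∀ t ∈ Ico 0 T,
    TendstoInMeasure P (fun j ω => forwardSum (p j) (fun s => Y s ω) (fun s => S s ω) t)
      atTop (I t)
  tendsto_terminal : ∀ᵐ ω ∂P, Tendsto (fun t => I t ω) (𝓝[<] T) (𝓝 (I T ω))

/-- The Markovian strategy `π_t = g(t, S_t)`, `t ∈ [0,T)`, replicates the claim `H` at time `T`,
and `V` is its value process: `V_0` is a constant, `V_t = V_0 + ∫_0^t π dS`, and `V_T = H`. -/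
structure IsMarkovianReplication {Ω : Type*} [MeasurableSpace Ω] (P : Measure Ω) (T : ℝ)
    (S : ℝ → Ω → ℝ) (g : ℝ → ℝ → ℝ) (V : ℝ → Ω → ℝ) (H : Ω → ℝ) : Prop where
  measurable : ∀ t ∈ Ico 0 T, Measurable (g t)
  initial : ∃ c : ℝ, ∀ᵐ ω ∂P, V 0 ω = c
  self_financing :
    IsForwardIntegral P T (fun t ω => g t (S t ω)) S (fun t ω => V t ω - V 0 ω)
  terminal : ∀ᵐ ω ∂P, V T ω = H ω

end

end GaussianHedging

namespace GaussianHedging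

/-! ### Elementary facts on partitions -/

/-! The argument is Föllmer's pathwise calculus: `X` need not be a semimartingale, and the delta
hedge works because its paths have the deterministic quadratic variation q².

Quadratic variation. For fixed u the function K(·, u) is non-decreasing and continuous except for a
jump from 0 to K(u,u) at u. Its squared increments over fine partitions therefore add up to K(u,u)²,
and integration in u gives the limit of the expected sums (`tendsto_sum_integral_sq_increments`). By
Isserlis' formula their variance is twice the sum of the squared covariances of increments. These
covariances are nonnegative with bounded sum, and the largest tends to 0
(`tendsto_sum_sq_covariance`), so convergence holds in L².

Value function. With F = f ∘ exp, v(t, S_t) is the Gaussian convolution `heat F τ` at the remaining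
variance τ = q²(T) - q²(t) (`value_eq_heat`), evaluated at Z_t = c + b(t) + X_t. Integrability at t
= 0 for every x dominates all Gaussian moments with τ ≤ q²(T) (`abs_pow_mul_exp_le_gaussBound`).
Hence `heat F` can be differentiated and solves the heat equation without smoothness of F.

Change of variables. By the heat equation, an increment of the value minus that of the hedge is
(heatDD - heatD)/2 · ((ΔZ)² - Δq²) up to a small remainder (`exists_abs_heat_increment_sub_le`). The
drift, being continuous of bounded variation, does not affect the squares in the limit. The
compensated squares of X, weighted by a continuous function, sum to o(1)
(`tendsto_weightedSum_zero`). Telescoping the value gives `tendsto_sum_heatD`.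

Probability. Every sequence of partitions has a subsequence along which almost every path has
quadratic variation q² (`HasQuadraticVariation.exists_seq_pathwise`), so the pathwise limit yields
the limit in probability. As t ↑ T the convolution returns F at its continuity points
(`GaussIntegrable.tendsto_heat`), and the law of X_T is absolutely continuous, so S_T almost surely
avoids the discontinuities of f. -/

theorem tendsto_of_forall_eventually_abs_sub_le {ι : Type*} {l : Filter ι} {g : ι → ℝ} {a : ℝ}
    (C : ℝ) (h : ∀ ε > 0, ∀ᶠ i in l, |g i - a| ≤ C * ε) : Tendsto g l (𝓝 a) := by
  rw [Metric.tendsto_nhds]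
  intro ε hε
  have hC : 0 < |C| + 1 := by positivity
  filter_upwards [h (ε / (|C| + 1)) (by positivity)] with i hi
  rw [Real.dist_eq]
  calc |g i - a| ≤ C * (ε / (|C| + 1)) := hi
    _ ≤ |C| * (ε / (|C| + 1)) := by gcongr; exact le_abs_self C
    _ < (|C| + 1) * (ε / (|C| + 1)) := by gcongr; linarith
    _ = ε := by field_simp

namespace TimePartition

variable {T : ℝ} (p : TimePartition T)

theorem strictMonoOn_pt : StrictMonoOn p.pt (Iic p.n) := by
  have key : ∀ i j, i < j → j ≤ p.n → p.pt i < p.pt j := by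
    intro i j hij
    induction j, hij using Nat.le_induction with
    | base => intro h; exact p.pt_lt i (by omega)
    | succ j hj ih => intro h; exact (ih (by omega)).trans (p.pt_lt j (by omega))
  exact fun i _ j hj hij => key i j hij hj

theorem pt_mono {i j : ℕ} (hij : i ≤ j) (hj : j ≤ p.n) : p.pt i ≤ p.pt j :=
  p.strictMonoOn_pt.monotoneOn (mem_Iic.2 (hij.trans hj)) (mem_Iic.2 hj) hij

theorem pt_mem {k : ℕ} (hk : k ≤ p.n) : p.pt k ∈ Icc 0 T :=
  ⟨p.pt_zero.symm.trans_le (p.pt_mono (Nat.zero_le k) hk), (p.pt_mono hk le_rfl).trans_eq p.pt_last⟩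

/-- Partition points increase, so sums restricted to t_k ≤ t run over an initial segment and can
telescope. The last clause lets the mesh control t - t_N. -/
theorem exists_filter_eq_range {t : ℝ} (ht : 0 ≤ t) :
    ∃ N ≤ p.n, (Finset.range p.n).filter (fun k => p.pt (k + 1) ≤ t) = Finset.range N ∧
      p.pt N ≤ t ∧ (N < p.n → t < p.pt (N + 1)) := by
  classical
  by_cases h : ∃ k, k < p.n ∧ t < p.pt (k + 1)
  · have hs := Nat.find_spec h
    refine ⟨Nat.find h, hs.1.le, ?_, ?_, fun _ => hs.2⟩
    · ext k
      simp only [Finset.mem_filter, Finset.mem_range]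
      constructor
      · rintro ⟨hk, hkt⟩
        by_contra hlt
        have := p.pt_mono (i := Nat.find h + 1) (j := k + 1) (by omega) (by omega)
        linarith [hs.2]
      · intro hk
        have := Nat.find_min h hk
        push Not at this
        exact ⟨hk.trans hs.1, this (hk.trans hs.1)⟩
    · rcases Nat.eq_zero_or_pos (Nat.find h) with h0 | h0
      · rw [h0, p.pt_zero]; exact ht
      · have := Nat.find_min h (Nat.sub_lt h0 one_pos)
        push Not at this
        have h2 := this (by omega)
        rwa [show Nat.find h - 1 + 1 = Nat.find h by omega] at h2
  · push Not at h
    refine ⟨p.n, le_rfl, ?_, ?_, fun h => absurd h (lt_irrefl _)⟩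
    · ext k
      simp only [Finset.mem_filter, Finset.mem_range]
      exact ⟨fun h => h.1, fun hk => ⟨hk, h k hk⟩⟩
    · rcases Nat.eq_zero_or_pos p.n with h0 | h0
      · rw [h0, p.pt_zero]; exact ht
      · have h2 := h (p.n - 1) (by omega)
        rwa [show p.n - 1 + 1 = p.n by omega] at h2

/-- The left inequality is strict because a Volterra kernel vanishes strictly before the diagonal,
but not on it. -/
theorem exists_mem_Ioc {u : ℝ} (hu : u ∈ Ioc 0 T) :
    ∃ k < p.n, p.pt k < u ∧ u ≤ p.pt (k + 1) := by
  classical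
  have h : ∃ k, k < p.n ∧ u ≤ p.pt (k + 1) := by
    have h0 : p.n ≠ 0 := by
      intro h0
      have := p.pt_last
      rw [h0, p.pt_zero] at this
      linarith [hu.1, hu.2]
    exact ⟨p.n - 1, by omega, by
      rw [Nat.sub_add_cancel (Nat.pos_of_ne_zero h0), p.pt_last]; exact hu.2⟩
  have hs := Nat.find_spec h
  refine ⟨Nat.find h, hs.1, ?_, hs.2⟩
  rcases Nat.eq_zero_or_pos (Nat.find h) with h0 | h0
  · rw [h0, p.pt_zero]; exact hu.1
  · have := Nat.find_min h (Nat.sub_lt h0 one_pos)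
    push Not at this
    have h2 := this (by omega)
    rwa [show Nat.find h - 1 + 1 = Nat.find h by omega] at h2

end TimePartition

/-! ### The kernel -/

section Kernel

variable {T : ℝ} {K : ℝ → ℝ → ℝ} {m : StieltjesFunction ℝ}

namespace IsRegularInvertibleKernel

theorem nonneg (hK : IsRegularInvertibleKernel T K m) {t s : ℝ} (ht : t ∈ Icc 0 T)
    (hs : s ∈ Ioc 0 T) : 0 ≤ K t s := by
  have h0 : (0 : ℝ) ∈ Icc 0 T := ⟨le_rfl, ht.1.trans ht.2⟩
  rw [← hK.volterra s hs 0 h0 hs.1]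
  exact hK.monotone s hs h0 ht ht.1

theorem le_terminal (hK : IsRegularInvertibleKernel T K m) {t s : ℝ} (ht : t ∈ Icc 0 T)
    (hs : s ∈ Ioc 0 T) : K t s ≤ K T s :=
  hK.monotone s hs ht ⟨ht.1.trans ht.2, le_rfl⟩ ht.2

/-- The section vanishes beyond `t`, so a single measure space serves all times. -/
theorem memLp_two (hK : IsRegularInvertibleKernel T K m) {t : ℝ} (ht : t ∈ Icc 0 T) :
    MemLp (K t) 2 (m.measure.restrict (Ioc 0 T)) := by
  have h1 : MemLp ((Ioc 0 t).indicator (K t)) 2 (m.measure.restrict (Ioc 0 T)) := by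
    rw [memLp_indicator_iff_restrict measurableSet_Ioc,
      Measure.restrict_restrict measurableSet_Ioc,
      inter_eq_left.2 (Ioc_subset_Ioc_right ht.2)]
    exact hK.memLp_section t ht
  refine h1.ae_eq ?_
  filter_upwards [ae_restrict_mem measurableSet_Ioc] with s hs
  by_cases hst : s ∈ Ioc 0 t
  · rw [indicator_of_mem hst]
  · rw [indicator_of_notMem hst, hK.volterra s hs t ht]
    by_contra hlt
    exact hst ⟨hs.1, not_lt.1 hlt⟩

theorem integrable_sq (hK : IsRegularInvertibleKernel T K m) {t : ℝ} (ht : t ∈ Icc 0 T) :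
    Integrable (fun u => K t u ^ 2) (m.measure.restrict (Ioc 0 T)) :=
  (hK.memLp_two ht).integrable_sq

theorem measure_singleton (hK : IsRegularInvertibleKernel T K m) {t : ℝ} (ht : t ∈ Ioc 0 T) :
    m.measure {t} = 0 := by
  rw [StieltjesFunction.measure_singleton]
  have h : Tendsto m (𝓝[<] t) (𝓝 (m t)) := by
    refine ((hK.m_continuous t ⟨ht.1.le, ht.2⟩).tendsto).mono_left ?_
    rw [← nhdsWithin_Ioo_eq_nhdsLT ht.1]
    exact nhdsWithin_mono _ fun x hx => ⟨hx.1.le, hx.2.le.trans ht.2⟩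
  rw [leftLim_eq_of_tendsto h]
  simp

/-- Continuity of `m` excludes atoms. This discards the one `u` for which K(·, u) may jump at time
`t`. -/
theorem ae_ne (hK : IsRegularInvertibleKernel T K m) (t : ℝ) :
    ∀ᵐ u ∂(m.measure.restrict (Ioc 0 T)), u ≠ t := by
  by_cases ht : t ∈ Ioc 0 T
  · refine ae_restrict_of_ae ?_
    rw [ae_iff]
    simpa using hK.measure_singleton ht
  · filter_upwards [ae_restrict_mem measurableSet_Ioc] with s hs h
    exact ht (h ▸ hs)

theorem continuousWithinAt_section (hK : IsRegularInvertibleKernel T K m) {t u : ℝ}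
    (ht : t ∈ Icc 0 T) (hu : u ∈ Ioc 0 T) (htu : u ≠ t) :
    ContinuousWithinAt (fun r => K r u) (Icc 0 T) t := by
  rcases lt_or_gt_of_ne htu with h | h
  · have := hK.continuous_section u hu t ⟨h.le, ht.2⟩
    refine this.mono_of_mem_nhdsWithin ?_
    filter_upwards [self_mem_nhdsWithin, mem_nhdsWithin_of_mem_nhds (Ioi_mem_nhds h)] with r hr hr'
    exact ⟨le_of_lt hr', hr.2⟩
  · refine (continuousWithinAt_const (b := (0 : ℝ))).congr_of_eventuallyEq ?_
      (hK.volterra u hu t ht h)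
    filter_upwards [self_mem_nhdsWithin, mem_nhdsWithin_of_mem_nhds (Iio_mem_nhds h)] with r hr hr'
    exact hK.volterra u hu r hr hr'

/-- The mean square distance `∫ (K(t,u) - K(s,u))² dm(u)` is a continuous function of `(s, t)`. -/
theorem continuousOn_meanSq (hK : IsRegularInvertibleKernel T K m) :
    ContinuousOn (fun a : ℝ × ℝ => ∫ u, (K a.1 u - K a.2 u) ^ 2 ∂(m.measure.restrict (Ioc 0 T)))
      (Icc 0 T ×ˢ Icc 0 T) := by
  rintro ⟨t, s⟩ ⟨ht, hs⟩
  -- Monotonicity makes `K T u ^ 2` a common majorant; pointwise convergence can fail only at the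
  -- null points `u = t` and `u = s`.
  refine tendsto_integral_filter_of_dominated_convergence (fun u => K T u ^ 2) ?_ ?_
    (hK.integrable_sq ⟨ht.1.trans ht.2, le_rfl⟩) ?_
  · filter_upwards [self_mem_nhdsWithin] with a ha
    exact ((hK.memLp_two ha.1).sub (hK.memLp_two ha.2)).integrable_sq.aestronglyMeasurable
  · filter_upwards [self_mem_nhdsWithin] with a ha
    filter_upwards [ae_restrict_mem measurableSet_Ioc] with u hu
    have h1 := hK.nonneg ha.1 hu
    have h2 := hK.nonneg ha.2 hu
    have h3 := hK.le_terminal ha.1 hu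
    have h4 := hK.le_terminal ha.2 hu
    rw [Real.norm_eq_abs, abs_of_nonneg (sq_nonneg _)]
    exact sq_le_sq' (by linarith) (by linarith)
  · filter_upwards [ae_restrict_mem measurableSet_Ioc, hK.ae_ne t, hK.ae_ne s] with u hu h1 h2
    have c1 : Tendsto (fun a : ℝ × ℝ => K a.1 u) (𝓝[Icc 0 T ×ˢ Icc 0 T] (t, s)) (𝓝 (K t u)) :=
      (hK.continuousWithinAt_section ht hu h1).tendsto.comp
        (continuousWithinAt_fst.tendsto_nhdsWithin fun a ha => ha.1)
    have c2 : Tendsto (fun a : ℝ × ℝ => K a.2 u) (𝓝[Icc 0 T ×ˢ Icc 0 T] (t, s)) (𝓝 (K s u)) :=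
      (hK.continuousWithinAt_section hs hu h2).tendsto.comp
        (continuousWithinAt_snd.tendsto_nhdsWithin fun a ha => ha.2)
    exact (c1.sub c2).pow 2

theorem aestronglyMeasurable_diag (hK : IsRegularInvertibleKernel T K m) :
    AEStronglyMeasurable (fun u => K u u ^ 2) (m.measure.restrict (Ioc 0 T)) :=
  (hK.diagonal.continuousOn.pow 2).aestronglyMeasurable measurableSet_Ioc

theorem integrable_diag (hK : IsRegularInvertibleKernel T K m) :
    Integrable (fun u => K u u ^ 2) (m.measure.restrict (Ioc 0 T)) := by
  rcases le_or_gt T 0 with hT | hT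
  · simp [Ioc_eq_empty (not_lt.2 hT)]
  refine (hK.integrable_sq ⟨hT.le, le_rfl⟩).mono' hK.aestronglyMeasurable_diag ?_
  filter_upwards [ae_restrict_mem measurableSet_Ioc] with u hu
  have hu' : u ∈ Icc 0 T := ⟨hu.1.le, hu.2⟩
  rw [Real.norm_eq_abs, abs_of_nonneg (sq_nonneg _)]
  exact pow_le_pow_left₀ (hK.nonneg hu' hu) (hK.le_terminal hu' hu) 2

/-- Moving `t` from the domain into the integrand allows dominated convergence on a fixed measure
space. -/
theorem qSq_eq {t : ℝ} (ht : t ∈ Icc 0 T) :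
    qSq K m t = ∫ u, (if u ≤ t then K u u ^ 2 else 0) ∂(m.measure.restrict (Ioc 0 T)) := by
  have h : (fun u => if u ≤ t then K u u ^ 2 else 0) = (Iic t).indicator fun u => K u u ^ 2 := by
    ext u; simp [indicator_apply]
  rw [h, integral_indicator measurableSet_Iic, Measure.restrict_restrict measurableSet_Iic, qSq]
  congr 2
  ext u
  simp only [mem_Ioc, mem_inter_iff, mem_Iic]
  constructor
  · exact fun h => ⟨h.2, h.1, h.2.trans ht.2⟩
  · exact fun h => ⟨h.2.1, h.1⟩

theorem continuousOn_qSq (hK : IsRegularInvertibleKernel T K m) :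
    ContinuousOn (qSq K m) (Icc 0 T) := by
  have : ContinuousOn (fun t => ∫ u, (if u ≤ t then K u u ^ 2 else 0)
      ∂(m.measure.restrict (Ioc 0 T))) (Icc 0 T) := by
    intro t ht
    refine tendsto_integral_filter_of_dominated_convergence (fun u => K u u ^ 2) ?_ ?_
      hK.integrable_diag ?_
    · refine Eventually.of_forall fun s => ?_
      have h : (fun u => if u ≤ s then K u u ^ 2 else 0) =
          (Iic s).indicator fun u => K u u ^ 2 := by
        ext u; simp [indicator_apply]
      rw [h]
      exact hK.aestronglyMeasurable_diag.indicator measurableSet_Iic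
    · refine Eventually.of_forall fun s => Eventually.of_forall fun u => ?_
      split_ifs
      · simp
      · simp; positivity
    · filter_upwards [hK.ae_ne t] with u hu
      rcases lt_or_gt_of_ne hu with h | h
      · rw [if_pos h.le]
        refine tendsto_const_nhds.congr' ?_
        filter_upwards [mem_nhdsWithin_of_mem_nhds (Ioi_mem_nhds h)] with s hs
        rw [if_pos (le_of_lt hs)]
      · rw [if_neg (not_le.2 h)]
        refine tendsto_const_nhds.congr' ?_
        filter_upwards [mem_nhdsWithin_of_mem_nhds (Iio_mem_nhds h)] with s hs
        rw [if_neg (not_le.2 hs)]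
  exact this.congr fun t ht => qSq_eq ht

/-- Along partitions with vanishing mesh, the sum of the squared increments of `K(·, u)` over
`[0, t]` only sees the jump at the diagonal. -/
theorem tendsto_sum_sq_increments (hK : IsRegularInvertibleKernel T K m)
    {p : ℕ → TimePartition T} (hp : MeshTendsToZero p) {t u : ℝ} (ht : t ∈ Icc 0 T)
    (hu : u ∈ Ioc 0 T) (hut : u ≠ t) :
    Tendsto (fun j => ∑ k ∈ (Finset.range (p j).n).filter (fun k => (p j).pt (k + 1) ≤ t),
      (K ((p j).pt (k + 1)) u - K ((p j).pt k) u) ^ 2) atTop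
      (𝓝 (if u ≤ t then K u u ^ 2 else 0)) := by
  have hu' : u ∈ Icc 0 T := ⟨hu.1.le, hu.2⟩
  rcases lt_or_gt_of_ne hut with h | h
  swap
  · rw [if_neg (not_le.2 h)]
    refine tendsto_const_nhds.congr fun j => (Finset.sum_eq_zero fun k hk => ?_).symm
    rw [Finset.mem_filter, Finset.mem_range] at hk
    have h1 := (p j).pt_lt k hk.1
    rw [hK.volterra u hu _ ((p j).pt_mem hk.1) (by linarith),
      hK.volterra u hu _ ((p j).pt_mem hk.1.le) (by linarith)]
    simp
  rw [if_pos h.le]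
  -- Two of the three units pay for comparing the squared jump with `K u u ^ 2`, the third for the
  -- increments after the jump.
  refine tendsto_of_forall_eventually_abs_sub_le (3 * K T u) fun ε hε => ?_
  have huc := isCompact_Icc.uniformContinuousOn_of_continuous (hK.continuous_section u hu)
  rw [Metric.uniformContinuousOn_iff] at huc
  obtain ⟨δ, hδ, hδε⟩ := huc ε hε
  -- A mesh below `t - u` forces the cell containing `u` to end before `t`, so that its jump is
  -- counted.
  filter_upwards [hp (min δ (t - u)) (lt_min hδ (by linarith))] with j hj
  obtain ⟨N, hN, hNe, hNt, hN'⟩ := (p j).exists_filter_eq_range ht.1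
  rw [hNe]
  obtain ⟨k₀, hk₀, h1, h2⟩ := (p j).exists_mem_Ioc hu
  have hmesh := hj k₀ hk₀
  have hk₀N : k₀ < N := by
    by_contra hlt
    push Not at hlt
    have := hN' (by omega)
    have h3 := (p j).pt_mono (i := N + 1) (j := k₀ + 1) (by omega) (by omega)
    have := min_le_right δ (t - u)
    linarith
  have hmem : ∀ k ≤ N, (p j).pt k ∈ Icc 0 T := fun k hk => (p j).pt_mem (hk.trans hN)
  rw [← Finset.sum_range_add_sum_Ico _ (Nat.succ_le_of_lt hk₀N), Finset.sum_range_succ,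
    Finset.sum_eq_zero, zero_add]
  swap
  · intro k hk
    rw [Finset.mem_range] at hk
    have h3 := (p j).pt_mono (i := k + 1) (j := k₀) (by omega) (by omega)
    have h4 := (p j).pt_mono (i := k) (j := k₀) (by omega) (by omega)
    rw [hK.volterra u hu _ (hmem _ (by omega)) (by linarith),
      hK.volterra u hu _ (hmem _ (by omega)) (by linarith)]
    simp
  rw [hK.volterra u hu _ (hmem _ hk₀N.le) h1, sub_zero]
  set a := K ((p j).pt (k₀ + 1)) u with ha
  have ha0 : 0 ≤ a := hK.nonneg (hmem _ hk₀N) hu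
  have haT : a ≤ K T u := hK.le_terminal (hmem _ hk₀N) hu
  have hd0 : 0 ≤ K u u := hK.nonneg hu' hu
  have hdT : K u u ≤ K T u := hK.le_terminal hu' hu
  have hclose : |a - K u u| < ε := by
    have := hδε _ ⟨h2, (hmem _ hk₀N).2⟩ u ⟨le_rfl, hu.2⟩ (by
      rw [Real.dist_eq, abs_of_nonneg (by linarith)]
      have := min_le_left δ (t - u)
      linarith)
    rwa [Real.dist_eq] at this
  have hrest : ∑ k ∈ Finset.Ico (k₀ + 1) N,
      (K ((p j).pt (k + 1)) u - K ((p j).pt k) u) ^ 2 ≤ ε * K T u := by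
    -- Past the diagonal every increment lies in [0, ε), so the squares are at most `ε` times a
    -- telescoping sum.
    calc _ ≤ ∑ k ∈ Finset.Ico (k₀ + 1) N, ε * (K ((p j).pt (k + 1)) u - K ((p j).pt k) u) := by
          refine Finset.sum_le_sum fun k hk => ?_
          rw [Finset.mem_Ico] at hk
          have hlt := (p j).pt_lt k (by omega)
          have hlow := (p j).pt_mono hk.1 (by omega)
          have hnn : 0 ≤ K ((p j).pt (k + 1)) u - K ((p j).pt k) u :=
            sub_nonneg.2 (hK.monotone u hu (hmem _ (by omega)) (hmem _ (by omega)) hlt.le)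
          have := hδε _ ⟨by linarith, (hmem (k + 1) (by omega)).2⟩ ((p j).pt k)
            ⟨by linarith, (hmem k (by omega)).2⟩ (by
              rw [Real.dist_eq, abs_of_nonneg (by linarith)]
              exact (hj k (by omega)).trans_le (min_le_left _ _))
          rw [Real.dist_eq, abs_of_nonneg hnn] at this
          rw [sq]
          exact mul_le_mul_of_nonneg_right this.le hnn
      _ = ε * (K ((p j).pt N) u - K ((p j).pt (k₀ + 1)) u) := by
          rw [← Finset.mul_sum, Finset.sum_Ico_eq_sub _ (Nat.succ_le_of_lt hk₀N),
            Finset.sum_range_sub (fun k => K ((p j).pt k) u),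
            Finset.sum_range_sub (fun k => K ((p j).pt k) u)]
          ring
      _ ≤ ε * K T u := by
          gcongr
          have := hK.le_terminal (hmem N le_rfl) hu
          linarith
  have hrest0 : 0 ≤ ∑ k ∈ Finset.Ico (k₀ + 1) N,
      (K ((p j).pt (k + 1)) u - K ((p j).pt k) u) ^ 2 := Finset.sum_nonneg fun k _ => sq_nonneg _
  have hsq : |a ^ 2 - K u u ^ 2| ≤ ε * (2 * K T u) := by
    rw [sq_sub_sq, abs_mul, mul_comm]
    refine mul_le_mul hclose.le ?_ (abs_nonneg _) hε.le
    rw [abs_of_nonneg (by positivity)]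
    linarith
  rw [abs_le] at hsq ⊢
  constructor <;> nlinarith [hsq.1, hsq.2]

end IsRegularInvertibleKernel

end Kernel

/-! ### Fourth moments of Gaussian random variables -/

/-- The moment is the fourth derivative at 0 of the moment generating function exp(v t²/2). -/
theorem integral_pow_four_gaussianReal (v : NNReal) :
    ∫ x, x ^ 4 ∂(gaussianReal 0 v) = 3 * (v : ℝ) ^ 2 := by
  have h0 : iteratedDeriv 4 (mgf id (gaussianReal 0 v)) 0 = ∫ x, x ^ 4 ∂(gaussianReal 0 v) := by
    rw [iteratedDeriv_mgf_zero (by simp)]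
    simp
  rw [← h0, mgf_id_gaussianReal]
  have hexp (t : ℝ) : HasDerivAt (fun t : ℝ => Real.exp (0 * t + v * t ^ 2 / 2))
      (v * t * Real.exp (0 * t + v * t ^ 2 / 2)) t := by
    have h1 : HasDerivAt (fun t : ℝ => 0 * t + v * t ^ 2 / 2) (v * t) t := by
      have := ((hasDerivAt_id t).const_mul 0).add
        (((hasDerivAt_pow 2 t).const_mul (v : ℝ)).div_const 2)
      convert! this using 1
      simp
      ring
    convert! h1.exp using 1
    ring
  have hstep (a a' : ℝ → ℝ) (ha : ∀ t, HasDerivAt a (a' t) t) :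
      deriv (fun t : ℝ => a t * Real.exp (0 * t + v * t ^ 2 / 2)) =
        fun t : ℝ => (a' t + a t * (v * t)) * Real.exp (0 * t + v * t ^ 2 / 2) := by
    ext t
    refine HasDerivAt.deriv ?_
    convert! (ha t).mul (hexp t) using 1
    ring
  have d1 : deriv (fun t : ℝ => Real.exp (0 * t + v * t ^ 2 / 2)) =
      fun t : ℝ => (v * t) * Real.exp (0 * t + v * t ^ 2 / 2) := by
    ext t; rw [(hexp t).deriv]
  have d2 := hstep (fun t => v * t) (fun _ => v) fun t => by
    simpa using (hasDerivAt_id t).const_mul (v : ℝ)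
  have d3 := hstep (fun t => v + v * t * (v * t)) (fun t => 2 * v ^ 2 * t) fun t => by
    have := ((((hasDerivAt_id t).const_mul (v : ℝ)).mul
      ((hasDerivAt_id t).const_mul (v : ℝ)))).const_add (v : ℝ)
    convert! this using 1
    simp; ring
  have d4 := hstep (fun t => 2 * v ^ 2 * t + (v + v * t * (v * t)) * (v * t))
      (fun t => 3 * v ^ 2 + 3 * v ^ 3 * t ^ 2) fun t => by
    have := (((hasDerivAt_id t).const_mul (3 * (v : ℝ) ^ 2))).add
      ((hasDerivAt_pow 3 t).const_mul ((v : ℝ) ^ 3))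
    convert! this using 1
    · ext t; simp; ring
    · simp; ring
  simp only [iteratedDeriv_succ, iteratedDeriv_zero]
  rw [d1, d2, d3, d4]
  simp

section Gaussian

variable {Ω : Type*} [MeasurableSpace Ω] {P : Measure Ω} {X Y : Ω → ℝ}

theorem integral_pow_four_of_hasGaussianLaw (hX : HasGaussianLaw X P) (h0 : ∫ ω, X ω ∂P = 0) :
    ∫ ω, X ω ^ 4 ∂P = 3 * (∫ ω, X ω ^ 2 ∂P) ^ 2 := by
  have h1 : ∫ ω, X ω ^ 4 ∂P = ∫ x, x ^ 4 ∂(P.map X) := by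
    rw [integral_map hX.aemeasurable (by fun_prop)]
  rw [h1, hX.map_eq_gaussianReal, h0, integral_pow_four_gaussianReal,
    Real.coe_toNNReal _ (variance_nonneg _ _), variance_of_integral_eq_zero hX.aemeasurable h0]

theorem integrable_pow_four_of_hasGaussianLaw (hX : HasGaussianLaw X P) :
    Integrable (fun ω => X ω ^ 4) P := by
  have := (hX.memLp (p := 4) (by simp)).integrable_norm_pow (by norm_num)
  simpa [Even.pow_abs (show Even 4 by decide)] using this

theorem integrable_sq_mul_sq (hXY : HasGaussianLaw (fun ω => (X ω, Y ω)) P) :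
    Integrable (fun ω => X ω ^ 2 * Y ω ^ 2) P := by
  refine ((integrable_pow_four_of_hasGaussianLaw hXY.fst).add
    (integrable_pow_four_of_hasGaussianLaw hXY.snd)).mono'
    ((hXY.fst.aemeasurable.pow_const 2).mul (hXY.snd.aemeasurable.pow_const 2)).aestronglyMeasurable
    (Eventually.of_forall fun ω => ?_)
  rw [Real.norm_eq_abs, abs_of_nonneg (by positivity)]
  simp only [Pi.add_apply]
  nlinarith [sq_nonneg (X ω ^ 2 - Y ω ^ 2), sq_nonneg (X ω ^ 2), sq_nonneg (Y ω ^ 2)]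

/-- Isserlis' formula for `E[X² Y²]`. -/
theorem integral_sq_mul_sq (hXY : HasGaussianLaw (fun ω => (X ω, Y ω)) P)
    (hX : ∫ ω, X ω ∂P = 0) (hY : ∫ ω, Y ω ∂P = 0) :
    ∫ ω, X ω ^ 2 * Y ω ^ 2 ∂P =
      (∫ ω, X ω ^ 2 ∂P) * (∫ ω, Y ω ^ 2 ∂P) + 2 * (∫ ω, X ω * Y ω ∂P) ^ 2 := by
  have iX := hXY.fst.integrable
  have iY := hXY.snd.integrable
  have i2X := hXY.fst.memLp_two.integrable_sq
  have i2Y := hXY.snd.memLp_two.integrable_sq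
  have iXY : Integrable (fun ω => X ω * Y ω) P := hXY.fst.memLp_two.integrable_mul hXY.snd.memLp_two
  have i2S : Integrable (fun ω => X ω ^ 2 + Y ω ^ 2) P := i2X.add i2Y
  have i4X := integrable_pow_four_of_hasGaussianLaw hXY.fst
  have i4Y := integrable_pow_four_of_hasGaussianLaw hXY.snd
  have i22 := integrable_sq_mul_sq hXY
  have i4a := integrable_pow_four_of_hasGaussianLaw hXY.fun_add
  have i4s := integrable_pow_four_of_hasGaussianLaw hXY.fun_sub
  have i4S : Integrable (fun ω => 2 * X ω ^ 4 + 2 * Y ω ^ 4) P :=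
    (i4X.const_mul 2).add (i4Y.const_mul 2)
  have e4a := integral_pow_four_of_hasGaussianLaw hXY.fun_add
    (by rw [integral_add iX iY, hX, hY]; simp)
  have e4s := integral_pow_four_of_hasGaussianLaw hXY.fun_sub
    (by rw [integral_sub iX iY, hX, hY]; simp)
  have e4X := integral_pow_four_of_hasGaussianLaw hXY.fst hX
  have e4Y := integral_pow_four_of_hasGaussianLaw hXY.snd hY
  have e2a : ∫ ω, (X ω + Y ω) ^ 2 ∂P =
      (∫ ω, X ω ^ 2 ∂P) + (∫ ω, Y ω ^ 2 ∂P) + 2 * ∫ ω, X ω * Y ω ∂P := by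
    rw [← integral_const_mul, ← integral_add i2X i2Y, ← integral_add i2S (iXY.const_mul 2)]
    congr 1 with ω; ring
  have e2s : ∫ ω, (X ω - Y ω) ^ 2 ∂P =
      (∫ ω, X ω ^ 2 ∂P) + (∫ ω, Y ω ^ 2 ∂P) - 2 * ∫ ω, X ω * Y ω ∂P := by
    rw [← integral_const_mul, ← integral_add i2X i2Y, ← integral_sub i2S (iXY.const_mul 2)]
    congr 1 with ω; ring
  -- Polarisation: X ± Y are again centred Gaussian, and the odd terms cancel in (X + Y)⁴ + (X -
  -- Y)⁴, so one-dimensional fourth moments suffice.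
  have key : (∫ ω, (X ω + Y ω) ^ 4 ∂P) + (∫ ω, (X ω - Y ω) ^ 4 ∂P) =
      2 * (∫ ω, X ω ^ 4 ∂P) + 2 * (∫ ω, Y ω ^ 4 ∂P) + 12 * ∫ ω, X ω ^ 2 * Y ω ^ 2 ∂P := by
    rw [← integral_add i4a i4s, ← integral_const_mul, ← integral_const_mul, ← integral_const_mul,
      ← integral_add (i4X.const_mul 2) (i4Y.const_mul 2),
      ← integral_add i4S (i22.const_mul 12)]
    congr 1 with ω; ring
  rw [e4a, e4s, e4X, e4Y, e2a, e2s] at key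
  linarith

/-- The second moment of the centred quadratic form `∑ Yₖ² - a` of a Gaussian family. -/
theorem integral_sum_sq_sub_sq [IsProbabilityMeasure P] {ι : Type*} (s : Finset ι)
    {Y : ι → Ω → ℝ}
    (hY : ∀ k ∈ s, ∀ l ∈ s, HasGaussianLaw (fun ω => (Y k ω, Y l ω)) P)
    (h0 : ∀ k ∈ s, ∫ ω, Y k ω ∂P = 0) (a : ℝ) :
    Integrable (fun ω => (∑ k ∈ s, Y k ω ^ 2 - a) ^ 2) P ∧
    ∫ ω, (∑ k ∈ s, Y k ω ^ 2 - a) ^ 2 ∂P =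
      (∑ k ∈ s, ∫ ω, Y k ω ^ 2 ∂P - a) ^ 2 +
        2 * ∑ k ∈ s, ∑ l ∈ s, (∫ ω, Y k ω * Y l ω ∂P) ^ 2 := by
  have i2 : ∀ k ∈ s, Integrable (fun ω => Y k ω ^ 2) P := fun k hk =>
    (hY k hk k hk).fst.memLp_two.integrable_sq
  have i22 : ∀ k ∈ s, ∀ l ∈ s, Integrable (fun ω => Y k ω ^ 2 * Y l ω ^ 2) P := fun k hk l hl =>
    integrable_sq_mul_sq (hY k hk l hl)
  have iS : Integrable (fun ω => ∑ k ∈ s, ∑ l ∈ s, Y k ω ^ 2 * Y l ω ^ 2) P :=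
    integrable_finsetSum _ fun k hk => integrable_finsetSum _ fun l hl => i22 k hk l hl
  have iS1 : Integrable (fun ω => 2 * a * ∑ k ∈ s, Y k ω ^ 2) P :=
    (integrable_finsetSum _ i2).const_mul _
  have hexp : (fun ω => (∑ k ∈ s, Y k ω ^ 2 - a) ^ 2) = fun ω =>
      ∑ k ∈ s, ∑ l ∈ s, Y k ω ^ 2 * Y l ω ^ 2 - 2 * a * ∑ k ∈ s, Y k ω ^ 2 + a ^ 2 := by
    ext ω
    rw [← Finset.sum_mul_sum]
    ring
  have iD : Integrable (fun ω =>
      ∑ k ∈ s, ∑ l ∈ s, Y k ω ^ 2 * Y l ω ^ 2 - 2 * a * ∑ k ∈ s, Y k ω ^ 2) P := iS.sub iS1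
  rw [hexp]
  refine ⟨iD.add (integrable_const _), ?_⟩
  rw [integral_add iD (integrable_const _), integral_sub iS iS1, integral_const_mul,
    integral_finsetSum _ i2,
    integral_finsetSum _ fun k hk => integrable_finsetSum _ fun l hl => i22 k hk l hl]
  have h1 : ∑ k ∈ s, ∫ ω, ∑ l ∈ s, Y k ω ^ 2 * Y l ω ^ 2 ∂P =
      ∑ k ∈ s, ∑ l ∈ s, ((∫ ω, Y k ω ^ 2 ∂P) * (∫ ω, Y l ω ^ 2 ∂P) +
        2 * (∫ ω, Y k ω * Y l ω ∂P) ^ 2) := by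
    refine Finset.sum_congr rfl fun k hk => ?_
    rw [integral_finsetSum _ fun l hl => i22 k hk l hl]
    exact Finset.sum_congr rfl fun l hl =>
      integral_sq_mul_sq (hY k hk l hl) (h0 k hk) (h0 l hl)
  rw [h1]
  simp only [Finset.sum_add_distrib, ← Finset.mul_sum, ← Finset.sum_mul]
  simp
  ring

end Gaussian

/-! ### The quadratic variation of a Gaussian Volterra process -/

namespace IsRegularInvertibleGaussianVolterra

variable {Ω : Type*} [MeasurableSpace Ω] {P : Measure Ω} {T : ℝ} {X : ℝ → Ω → ℝ}
  {K : ℝ → ℝ → ℝ} {m : StieltjesFunction ℝ}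

theorem hasGaussianLaw (hX : IsRegularInvertibleGaussianVolterra P T X K m) {t : ℝ}
    (ht : t ∈ Icc 0 T) : HasGaussianLaw (X t) P :=
  hX.gaussian.hasGaussianLaw_eval ⟨t, ht⟩

theorem hasGaussianLaw_increments (hX : IsRegularInvertibleGaussianVolterra P T X K m)
    {a b c d : ℝ} (ha : a ∈ Icc 0 T) (hb : b ∈ Icc 0 T) (hc : c ∈ Icc 0 T) (hd : d ∈ Icc 0 T) :
    HasGaussianLaw (fun ω => (X b ω - X a ω, X d ω - X c ω)) P := by
  classical
  let I : Finset (Icc (0 : ℝ) T) := {⟨a, ha⟩, ⟨b, hb⟩, ⟨c, hc⟩, ⟨d, hd⟩}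
  let π (i : I) : (I → ℝ) →L[ℝ] ℝ := ContinuousLinearMap.proj i
  exact (hX.gaussian.hasGaussianLaw I).map
    ((π ⟨⟨b, hb⟩, by simp [I]⟩ - π ⟨⟨a, ha⟩, by simp [I]⟩).prod
      (π ⟨⟨d, hd⟩, by simp [I]⟩ - π ⟨⟨c, hc⟩, by simp [I]⟩))

theorem integral_mul_eq (hX : IsRegularInvertibleGaussianVolterra P T X K m) {t s : ℝ}
    (ht : t ∈ Icc 0 T) (hs : s ∈ Icc 0 T) :
    ∫ ω, X t ω * X s ω ∂P = ∫ u, K t u * K s u ∂(m.measure.restrict (Ioc 0 T)) := by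
  rw [hX.covariance t ht s hs]
  have hsub : Ioc 0 (min t s) ⊆ Ioc 0 T := Ioc_subset_Ioc_right ((min_le_left _ _).trans ht.2)
  refine (setIntegral_eq_of_subset_of_forall_sdiff_eq_zero measurableSet_Ioc hsub ?_).symm
  rintro u ⟨hu, hu'⟩
  have : min t s < u := by
    by_contra h
    exact hu' ⟨hu.1, not_lt.1 h⟩
  rcases min_lt_iff.1 this with h | h
  · rw [hX.kernel.volterra u hu t ht h, zero_mul]
  · rw [hX.kernel.volterra u hu s hs h, mul_zero]

theorem integral_increments_mul (hX : IsRegularInvertibleGaussianVolterra P T X K m)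
    {a b c d : ℝ} (ha : a ∈ Icc 0 T) (hb : b ∈ Icc 0 T) (hc : c ∈ Icc 0 T) (hd : d ∈ Icc 0 T) :
    ∫ ω, (X b ω - X a ω) * (X d ω - X c ω) ∂P =
      ∫ u, (K b u - K a u) * (K d u - K c u) ∂(m.measure.restrict (Ioc 0 T)) := by
  have hL := fun {t : ℝ} (ht : t ∈ Icc 0 T) => (hX.hasGaussianLaw ht).memLp_two
  have hM := fun {t : ℝ} (ht : t ∈ Icc 0 T) => hX.kernel.memLp_two ht
  simp only [sub_mul, mul_sub]
  have i1 := fun {t s : ℝ} (ht : t ∈ Icc 0 T) (hs : s ∈ Icc 0 T) =>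
    (show Integrable (fun ω => X t ω * X s ω) P from (hL ht).integrable_mul (hL hs))
  have i2 := fun {t s : ℝ} (ht : t ∈ Icc 0 T) (hs : s ∈ Icc 0 T) =>
    (show Integrable (fun u => K t u * K s u) (m.measure.restrict (Ioc 0 T)) from
      (hM ht).integrable_mul (hM hs))
  rw [integral_sub, integral_sub (i1 hb hd) (i1 ha hd), integral_sub (i1 hb hc) (i1 ha hc),
    integral_sub, integral_sub (i2 hb hd) (i2 ha hd), integral_sub (i2 hb hc) (i2 ha hc),
    hX.integral_mul_eq hb hd, hX.integral_mul_eq hb hc, hX.integral_mul_eq ha hd,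
    hX.integral_mul_eq ha hc]
  · exact (i2 hb hd).sub (i2 ha hd)
  · exact (i2 hb hc).sub (i2 ha hc)
  · exact (i1 hb hd).sub (i1 ha hd)
  · exact (i1 hb hc).sub (i1 ha hc)

/-- The covariance formula turns the expectations into the dm-integral of the squared increments of
K(·, u). Those increments are nonnegative, so the sum of squares is at most the square of the
telescoped sum, hence at most `K T u ^ 2`, which dominates. -/
theorem tendsto_sum_integral_sq_increments (hX : IsRegularInvertibleGaussianVolterra P T X K m)
    {p : ℕ → TimePartition T} (hp : MeshTendsToZero p) {t : ℝ} (ht : t ∈ Icc 0 T) :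
    Tendsto (fun j => ∑ k ∈ (Finset.range (p j).n).filter (fun k => (p j).pt (k + 1) ≤ t),
      ∫ ω, (X ((p j).pt (k + 1)) ω - X ((p j).pt k) ω) ^ 2 ∂P) atTop (𝓝 (qSq K m t)) := by
  have hK := hX.kernel
  have hT : T ∈ Icc 0 T := ⟨ht.1.trans ht.2, le_rfl⟩
  have hint : ∀ j, ∀ k < (p j).n, Integrable
      (fun u => (K ((p j).pt (k + 1)) u - K ((p j).pt k) u) ^ 2)
      (m.measure.restrict (Ioc 0 T)) := fun j k hk =>
    ((hK.memLp_two ((p j).pt_mem hk)).sub (hK.memLp_two ((p j).pt_mem hk.le))).integrable_sq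
  have heq : ∀ j, ∑ k ∈ (Finset.range (p j).n).filter (fun k => (p j).pt (k + 1) ≤ t),
      ∫ ω, (X ((p j).pt (k + 1)) ω - X ((p j).pt k) ω) ^ 2 ∂P =
      ∫ u, ∑ k ∈ (Finset.range (p j).n).filter (fun k => (p j).pt (k + 1) ≤ t),
        (K ((p j).pt (k + 1)) u - K ((p j).pt k) u) ^ 2 ∂(m.measure.restrict (Ioc 0 T)) := by
    intro j
    rw [integral_finsetSum]
    · refine Finset.sum_congr rfl fun k hk => ?_
      rw [Finset.mem_filter, Finset.mem_range] at hk
      simp only [sq]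
      exact hX.integral_increments_mul ((p j).pt_mem hk.1.le) ((p j).pt_mem hk.1)
        ((p j).pt_mem hk.1.le) ((p j).pt_mem hk.1)
    · intro k hk
      rw [Finset.mem_filter, Finset.mem_range] at hk
      exact hint j k hk.1
  simp only [heq]
  rw [IsRegularInvertibleKernel.qSq_eq ht]
  refine tendsto_integral_of_dominated_convergence (fun u => K T u ^ 2) ?_
    (hK.integrable_sq hT) ?_ ?_
  · intro j
    refine (integrable_finsetSum _ fun k hk => ?_).aestronglyMeasurable
    rw [Finset.mem_filter, Finset.mem_range] at hk
    exact hint j k hk.1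
  · intro j
    filter_upwards [ae_restrict_mem measurableSet_Ioc] with u hu
    rw [Real.norm_eq_abs, abs_of_nonneg (Finset.sum_nonneg fun k _ => sq_nonneg _)]
    obtain ⟨N, hN, hNe, -, -⟩ := (p j).exists_filter_eq_range ht.1
    rw [hNe]
    have hmono : ∀ k ∈ Finset.range N, 0 ≤ K ((p j).pt (k + 1)) u - K ((p j).pt k) u := by
      intro k hk
      rw [Finset.mem_range] at hk
      exact sub_nonneg.2 (hK.monotone u hu ((p j).pt_mem (by omega)) ((p j).pt_mem (by omega))
        ((p j).pt_lt k (by omega)).le)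
    refine (Finset.sum_sq_le_sq_sum_of_nonneg hmono).trans ?_
    rw [Finset.sum_range_sub (fun k => K ((p j).pt k) u)]
    have h1 := hK.le_terminal ((p j).pt_mem hN) hu
    have h2 := hK.nonneg ((p j).pt_mem (Nat.zero_le _)) hu
    have h3 := hK.monotone u hu ((p j).pt_mem (Nat.zero_le _)) ((p j).pt_mem hN)
      ((p j).pt_mono (Nat.zero_le _) hN)
    exact pow_le_pow_left₀ (sub_nonneg.2 h3) (by linarith) 2
  · filter_upwards [ae_restrict_mem measurableSet_Ioc, hK.ae_ne t] with u hu hut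
    exact hK.tendsto_sum_sq_increments hp ht hu hut

/-- Since all covariances are nonnegative, the sum of their squares is at most the largest one times
their total. The total telescopes under the integral and is bounded by ∫ K(T,u)² dm(u); the largest
is small by uniform continuity of the mean square distance. -/
theorem tendsto_sum_sq_covariance (hX : IsRegularInvertibleGaussianVolterra P T X K m)
    {p : ℕ → TimePartition T} (hp : MeshTendsToZero p) {t : ℝ} (ht : t ∈ Icc 0 T) :
    Tendsto (fun j => ∑ k ∈ (Finset.range (p j).n).filter (fun k => (p j).pt (k + 1) ≤ t),
      ∑ l ∈ (Finset.range (p j).n).filter (fun k => (p j).pt (k + 1) ≤ t),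
      (∫ ω, (X ((p j).pt (k + 1)) ω - X ((p j).pt k) ω) *
        (X ((p j).pt (l + 1)) ω - X ((p j).pt l) ω) ∂P) ^ 2) atTop (𝓝 0) := by
  have hK := hX.kernel
  have hT : T ∈ Icc 0 T := ⟨ht.1.trans ht.2, le_rfl⟩
  set ν := m.measure.restrict (Ioc 0 T) with hν
  refine tendsto_of_forall_eventually_abs_sub_le (∫ u, K T u ^ 2 ∂ν) fun ε hε => ?_
  have huc := (isCompact_Icc.prod isCompact_Icc).uniformContinuousOn_of_continuous
    hK.continuousOn_meanSq
  rw [Metric.uniformContinuousOn_iff] at huc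
  obtain ⟨δ, hδ, hδε⟩ := huc ε hε
  filter_upwards [hp δ hδ] with j hj
  obtain ⟨N, hN, hNe, -, -⟩ := (p j).exists_filter_eq_range ht.1
  rw [hNe]
  have hmem : ∀ k ≤ N, (p j).pt k ∈ Icc 0 T := fun k hk => (p j).pt_mem (hk.trans hN)
  set D : ℕ → ℝ → ℝ := fun k u => K ((p j).pt (k + 1)) u - K ((p j).pt k) u with hD
  have hD2 : ∀ k < N, MemLp (D k) 2 ν := fun k hk =>
    (hK.memLp_two (hmem _ hk)).sub (hK.memLp_two (hmem _ hk.le))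
  have hDi : ∀ k < N, ∀ l < N, Integrable (fun u => D k u * D l u) ν := fun k hk l hl =>
    (hD2 k hk).integrable_mul (hD2 l hl)
  have hD0 : ∀ u ∈ Ioc 0 T, ∀ k < N, 0 ≤ D k u := fun u hu k hk =>
    sub_nonneg.2 (hK.monotone u hu (hmem _ hk.le) (hmem _ hk) ((p j).pt_lt k (by omega)).le)
  have hcov : ∀ k < N, ∀ l < N, ∫ ω, (X ((p j).pt (k + 1)) ω - X ((p j).pt k) ω) *
        (X ((p j).pt (l + 1)) ω - X ((p j).pt l) ω) ∂P = ∫ u, D k u * D l u ∂ν :=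
    fun k hk l hl => hX.integral_increments_mul (hmem _ hk.le) (hmem _ hk) (hmem _ hl.le)
      (hmem _ hl)
  have hc0 : ∀ k < N, ∀ l < N, 0 ≤ ∫ u, D k u * D l u ∂ν := fun k hk l hl =>
    integral_nonneg_of_ae (by
      filter_upwards [ae_restrict_mem measurableSet_Ioc] with u hu
      exact mul_nonneg (hD0 u hu k hk) (hD0 u hu l hl))
  have hcdiag : ∀ k < N, ∫ u, D k u ^ 2 ∂ν ≤ ε := fun k hk => by
    have hlt := (p j).pt_lt k (by omega)
    -- The comparison is with a diagonal point, where the mean square distance is 0.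
    have := hδε ((p j).pt (k + 1), (p j).pt k) ⟨hmem _ hk, hmem _ hk.le⟩
      ((p j).pt k, (p j).pt k) ⟨hmem _ hk.le, hmem _ hk.le⟩ (by
        rw [Prod.dist_eq, dist_self, Real.dist_eq, abs_of_nonneg (by linarith)]
        exact max_lt (hj k (by omega)) hδ)
    simp only [sub_self, ne_eq, OfNat.ofNat_ne_zero, not_false_eq_true, zero_pow,
      integral_zero, dist_zero_right, Real.norm_eq_abs] at this
    exact (le_abs_self _).trans this.le
  have hcε : ∀ k < N, ∀ l < N, ∫ u, D k u * D l u ∂ν ≤ ε := fun k hk l hl => by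
    have h1 : ∫ u, 2 * (D k u * D l u) ∂ν ≤ ∫ u, (D k u ^ 2 + D l u ^ 2) ∂ν := by
      refine integral_mono ((hDi k hk l hl).const_mul 2)
        ((hD2 k hk).integrable_sq.add (hD2 l hl).integrable_sq) fun u => ?_
      nlinarith [sq_nonneg (D k u - D l u)]
    rw [integral_const_mul, integral_add (hD2 k hk).integrable_sq (hD2 l hl).integrable_sq] at h1
    linarith [hcdiag k hk, hcdiag l hl]
  have hsum : ∑ k ∈ Finset.range N, ∑ l ∈ Finset.range N, ∫ u, D k u * D l u ∂ν ≤
      ∫ u, K T u ^ 2 ∂ν := by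
    have h1 : ∑ k ∈ Finset.range N, ∑ l ∈ Finset.range N, ∫ u, D k u * D l u ∂ν =
        ∫ u, ∑ k ∈ Finset.range N, ∑ l ∈ Finset.range N, D k u * D l u ∂ν := by
      rw [integral_finsetSum]
      · refine Finset.sum_congr rfl fun k hk => ?_
        rw [integral_finsetSum]
        exact fun l hl => hDi k (Finset.mem_range.1 hk) l (Finset.mem_range.1 hl)
      · exact fun k hk => integrable_finsetSum _ fun l hl =>
          hDi k (Finset.mem_range.1 hk) l (Finset.mem_range.1 hl)
    rw [h1]
    refine integral_mono_ae (integrable_finsetSum _ fun k hk => integrable_finsetSum _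
      fun l hl => hDi k (Finset.mem_range.1 hk) l (Finset.mem_range.1 hl))
      (hK.integrable_sq hT) ?_
    filter_upwards [ae_restrict_mem measurableSet_Ioc] with u hu
    rw [← Finset.sum_mul_sum, ← sq]
    refine pow_le_pow_left₀ (Finset.sum_nonneg fun k hk => hD0 u hu k (Finset.mem_range.1 hk)) ?_ 2
    simp only [hD]
    rw [Finset.sum_range_sub (fun k => K ((p j).pt k) u)]
    have h1 := hK.le_terminal (hmem N le_rfl) hu
    have h2 := hK.nonneg (hmem 0 (Nat.zero_le _)) hu
    linarith
  rw [sub_zero, abs_of_nonneg (Finset.sum_nonneg fun k _ => Finset.sum_nonneg fun l _ =>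
    sq_nonneg _)]
  calc _ ≤ ∑ k ∈ Finset.range N, ∑ l ∈ Finset.range N, (∫ u, D k u * D l u ∂ν) * ε := by
        refine Finset.sum_le_sum fun k hk => Finset.sum_le_sum fun l hl => ?_
        rw [Finset.mem_range] at hk hl
        rw [hcov k hk l hl, sq]
        exact mul_le_mul_of_nonneg_left (hcε k hk l hl) (hc0 k hk l hl)
    _ = (∑ k ∈ Finset.range N, ∑ l ∈ Finset.range N, ∫ u, D k u * D l u ∂ν) * ε := by
        simp only [Finset.sum_mul]
    _ ≤ _ := by gcongr

/-- The mean square error is the squared bias plus twice the sum of squared covariances. Both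
vanish, and Chebyshev's inequality concludes. -/
theorem hasQuadraticVariation [IsProbabilityMeasure P]
    (hX : IsRegularInvertibleGaussianVolterra P T X K m) :
    HasQuadraticVariation P T X (qSq K m) := by
  intro p hp t ht
  rw [tendstoInMeasure_iff_measureReal_norm]
  intro ε hε
  have hmom := fun j => integral_sum_sq_sub_sq (P := P)
    ((Finset.range (p j).n).filter (fun k => (p j).pt (k + 1) ≤ t))
    (Y := fun k ω => X ((p j).pt (k + 1)) ω - X ((p j).pt k) ω)
    (fun k hk l hl => by
      rw [Finset.mem_filter, Finset.mem_range] at hk hl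
      exact hX.hasGaussianLaw_increments ((p j).pt_mem hk.1.le) ((p j).pt_mem hk.1)
        ((p j).pt_mem hl.1.le) ((p j).pt_mem hl.1))
    (fun k hk => by
      rw [Finset.mem_filter, Finset.mem_range] at hk
      rw [integral_sub (hX.hasGaussianLaw ((p j).pt_mem hk.1)).integrable
        (hX.hasGaussianLaw ((p j).pt_mem hk.1.le)).integrable,
        hX.centered _ ((p j).pt_mem hk.1), hX.centered _ ((p j).pt_mem hk.1.le), sub_zero])
    (qSq K m t)
  have hlim : Tendsto (fun j => ∫ ω, (qvSum (p j) (fun s => X s ω) t - qSq K m t) ^ 2 ∂P) atTop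
      (𝓝 0) := by
    simp only [qvSum, (hmom _).2]
    have := (((hX.tendsto_sum_integral_sq_increments hp ht).sub_const (qSq K m t)).pow 2).add
      ((hX.tendsto_sum_sq_covariance hp ht).const_mul 2)
    simpa using this
  have hlim' := hlim.const_mul (ε ^ 2)⁻¹
  rw [mul_zero] at hlim'
  refine squeeze_zero (fun j => measureReal_nonneg) (fun j => ?_) hlim'
  have h1 := mul_meas_ge_le_integral_of_nonneg
    (Eventually.of_forall fun ω => sq_nonneg (qvSum (p j) (fun s => X s ω) t - qSq K m t))
    (hmom j).1 (ε ^ 2)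
  have h2 : {ω | ε ≤ ‖qvSum (p j) (fun s => X s ω) t - qSq K m t‖} =
      {ω | ε ^ 2 ≤ (qvSum (p j) (fun s => X s ω) t - qSq K m t) ^ 2} := by
    ext ω
    simp only [mem_ofPred_eq, Real.norm_eq_abs]
    rw [← sq_abs (qvSum _ _ _ - _)]
    exact (pow_le_pow_iff_left₀ hε.le (abs_nonneg _) two_ne_zero).symm
  rw [h2, inv_mul_eq_div, le_div_iff₀ (by positivity), mul_comm]
  exact h1

end IsRegularInvertibleGaussianVolterra

/-! ### Gaussian convolutions -/

/-- `∫ F(w) (w - y)ⁿ exp(-(w - y)² / (2τ)) dw`. -/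
noncomputable def gaussMoment (F : ℝ → ℝ) (n : ℕ) (τ y : ℝ) : ℝ :=
  ∫ w, F w * ((w - y) ^ n * Real.exp (-(w - y) ^ 2 / (2 * τ)))

/-- `F` is integrable against all Gaussian densities of variance `Q`. -/
def GaussIntegrable (F : ℝ → ℝ) (Q : ℝ) : Prop :=
  ∀ y, Integrable fun w => F w * Real.exp (-(w - y) ^ 2 / (2 * Q))

/-- A bound for `|w - y|ⁿ exp(-(w - y)² / (2τ))`, uniform in `|y| ≤ R` and `τ ≤ Q`. -/
noncomputable def gaussBound (Q R : ℝ) (n : ℕ) (w : ℝ) : ℝ :=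
  n.factorial * Real.exp (R + (R + Q) ^ 2 / (2 * Q)) *
    (Real.exp (-(w - (R + Q)) ^ 2 / (2 * Q)) + Real.exp (-(w - -(R + Q)) ^ 2 / (2 * Q)))

/-- The power is absorbed by n! exp|w - y|, and the smaller variance is replaced by `Q`. Completing
the square then leaves Gaussian weights of the same variance `Q`, so integrability of `F` against
those is enough. -/
theorem abs_pow_mul_exp_le_gaussBound {Q R τ y : ℝ} (hτ : 0 < τ) (hτQ : τ ≤ Q)
    (hy : |y| ≤ R) (n : ℕ) (w : ℝ) :
    |(w - y) ^ n * Real.exp (-(w - y) ^ 2 / (2 * τ))| ≤ gaussBound Q R n w := by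
  have hQ : 0 < Q := hτ.trans_le hτQ
  have hR : 0 ≤ R := (abs_nonneg y).trans hy
  have h1 : |w - y| ^ n ≤ n.factorial * Real.exp |w - y| := by
    have := Real.pow_div_factorial_le_exp |w - y| (abs_nonneg _) n
    rwa [div_le_iff₀' (by positivity)] at this
  have h2 : Real.exp (-(w - y) ^ 2 / (2 * τ)) ≤ Real.exp (-(w - y) ^ 2 / (2 * Q)) := by
    rw [Real.exp_le_exp, neg_div, neg_div, neg_le_neg_iff]
    gcongr
  -- The terms |w| and |w| R / Q, linear in |w|, shift the centre of the square to R + Q.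
  have h3 : |w - y| + -(w - y) ^ 2 / (2 * Q) ≤
      R + (R + Q) ^ 2 / (2 * Q) + -(|w| - (R + Q)) ^ 2 / (2 * Q) := by
    have e1 : |w - y| ≤ |w| + R := (abs_sub w y).trans (by linarith)
    have e2 : w * y ≤ |w| * R := (le_abs_self _).trans
      ((abs_mul w y).le.trans (mul_le_mul_of_nonneg_left hy (abs_nonneg w)))
    have e3 : -(w - y) ^ 2 / (2 * Q) ≤ (-|w| ^ 2 + 2 * (|w| * R)) / (2 * Q) := by
      gcongr
      rw [sq_abs]
      nlinarith [sq_nonneg y]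
    have e4 : (R + Q) ^ 2 / (2 * Q) + -(|w| - (R + Q)) ^ 2 / (2 * Q) =
        (-|w| ^ 2 + 2 * (|w| * R)) / (2 * Q) + |w| := by
      field_simp
      ring
    linarith
  have h4 : Real.exp (-(|w| - (R + Q)) ^ 2 / (2 * Q)) ≤
      Real.exp (-(w - (R + Q)) ^ 2 / (2 * Q)) + Real.exp (-(w - -(R + Q)) ^ 2 / (2 * Q)) := by
    rcases abs_cases w with ⟨h, -⟩ | ⟨h, -⟩
    · rw [h]; linarith [Real.exp_pos (-(w - -(R + Q)) ^ 2 / (2 * Q))]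
    · rw [h, show (-w - (R + Q)) ^ 2 = (w - -(R + Q)) ^ 2 by ring]
      linarith [Real.exp_pos (-(w - (R + Q)) ^ 2 / (2 * Q))]
  rw [abs_mul, abs_pow, abs_of_pos (Real.exp_pos _), gaussBound]
  calc |w - y| ^ n * Real.exp (-(w - y) ^ 2 / (2 * τ))
      ≤ n.factorial * Real.exp |w - y| * Real.exp (-(w - y) ^ 2 / (2 * Q)) := by gcongr
    _ = n.factorial * Real.exp (|w - y| + -(w - y) ^ 2 / (2 * Q)) := by rw [Real.exp_add]; ring
    _ ≤ n.factorial * Real.exp (R + (R + Q) ^ 2 / (2 * Q) + -(|w| - (R + Q)) ^ 2 / (2 * Q)) := by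
        gcongr
    _ = n.factorial * Real.exp (R + (R + Q) ^ 2 / (2 * Q)) *
          Real.exp (-(|w| - (R + Q)) ^ 2 / (2 * Q)) := by rw [Real.exp_add]; ring
    _ ≤ _ := by gcongr

namespace GaussIntegrable

variable {F : ℝ → ℝ} {Q : ℝ}

/-- The weight is continuous and never zero, so it can be divided out. -/
theorem aestronglyMeasurable (hF : GaussIntegrable F Q) : AEStronglyMeasurable F volume := by
  have h := (hF 0).aestronglyMeasurable.mul
    (Continuous.aestronglyMeasurable (μ := volume)
      (f := fun w : ℝ => Real.exp ((w - 0) ^ 2 / (2 * Q))) (by fun_prop))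
  refine h.congr (Eventually.of_forall fun w => ?_)
  simp only [Pi.mul_apply]
  rw [mul_assoc, ← Real.exp_add, neg_div, neg_add_cancel, Real.exp_zero, mul_one]

theorem integrable_bound (hF : GaussIntegrable F Q) (R : ℝ) (n : ℕ) :
    Integrable fun w => ‖F w‖ * gaussBound Q R n w := by
  have h := ((hF (R + Q)).norm.add (hF (-(R + Q))).norm).const_mul
    (n.factorial * Real.exp (R + (R + Q) ^ 2 / (2 * Q)))
  refine h.congr (Eventually.of_forall fun w => ?_)
  simp only [Pi.add_apply, norm_mul, Real.norm_eq_abs, abs_of_pos (Real.exp_pos _), gaussBound]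
  ring

theorem aestronglyMeasurable_integrand (hF : GaussIntegrable F Q) (n : ℕ) (τ y : ℝ) :
    AEStronglyMeasurable
      (fun w => F w * ((w - y) ^ n * Real.exp (-(w - y) ^ 2 / (2 * τ)))) volume :=
  hF.aestronglyMeasurable.mul (Continuous.aestronglyMeasurable (by fun_prop))

theorem norm_integrand_le {R τ y : ℝ} (hτ : 0 < τ) (hτQ : τ ≤ Q) (hy : |y| ≤ R) (n : ℕ) (w : ℝ) :
    ‖F w * ((w - y) ^ n * Real.exp (-(w - y) ^ 2 / (2 * τ)))‖ ≤ ‖F w‖ * gaussBound Q R n w := by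
  rw [norm_mul]
  exact mul_le_mul_of_nonneg_left (abs_pow_mul_exp_le_gaussBound hτ hτQ hy n w) (norm_nonneg _)

theorem integrable_integrand (hF : GaussIntegrable F Q) {τ : ℝ} (hτ : 0 < τ) (hτQ : τ ≤ Q)
    (n : ℕ) (y : ℝ) :
    Integrable fun w => F w * ((w - y) ^ n * Real.exp (-(w - y) ^ 2 / (2 * τ))) :=
  (hF.integrable_bound |y| n).mono' (hF.aestronglyMeasurable_integrand n τ y)
    (Eventually.of_forall (norm_integrand_le hτ hτQ le_rfl n))

theorem continuousOn_gaussMoment (hF : GaussIntegrable F Q) (n : ℕ) :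
    ContinuousOn (fun a : ℝ × ℝ => gaussMoment F n a.1 a.2) (Ioc 0 Q ×ˢ univ) := by
  rintro ⟨τ, y⟩ ⟨hτ, -⟩
  have hmem : ∀ᶠ a : ℝ × ℝ in 𝓝[Ioc 0 Q ×ˢ univ] (τ, y), |a.2| ≤ |y| + 1 := by
    refine mem_nhdsWithin_of_mem_nhds ?_
    have : Tendsto (fun a : ℝ × ℝ => |a.2|) (𝓝 (τ, y)) (𝓝 |y|) :=
      (continuous_snd.abs.tendsto (τ, y))
    exact this.eventually_le_const (by linarith)
  refine tendsto_integral_filter_of_dominated_convergence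
    (fun w => ‖F w‖ * gaussBound Q (|y| + 1) n w) ?_ ?_ (hF.integrable_bound _ n) ?_
  · exact Eventually.of_forall fun a => hF.aestronglyMeasurable_integrand n a.1 a.2
  · filter_upwards [self_mem_nhdsWithin, hmem] with a ha ha'
    exact Eventually.of_forall (norm_integrand_le ha.1.1 ha.1.2 ha' n)
  · refine Eventually.of_forall fun w => ?_
    have hτ0 : 2 * τ ≠ 0 := by have := hτ.1; positivity
    have : ContinuousAt (fun a : ℝ × ℝ =>
        F w * ((w - a.2) ^ n * Real.exp (-(w - a.2) ^ 2 / (2 * a.1)))) (τ, y) := by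
      refine continuousAt_const.mul (ContinuousAt.mul (by fun_prop) ?_)
      exact Real.continuous_exp.continuousAt.comp
        (ContinuousAt.div (by fun_prop) (by fun_prop) hτ0)
    exact this.tendsto.mono_left nhdsWithin_le_nhds

theorem hasDerivAt_exp_snd (τ w y : ℝ) (hτ : τ ≠ 0) :
    HasDerivAt (fun y => Real.exp (-(w - y) ^ 2 / (2 * τ)))
      ((w - y) / τ * Real.exp (-(w - y) ^ 2 / (2 * τ))) y := by
  have h : HasDerivAt (fun y => -(w - y) ^ 2 / (2 * τ)) ((w - y) / τ) y := by
    have := ((((hasDerivAt_id y).const_sub w).pow 2).neg).div_const (2 * τ)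
    convert! this using 1
    simp
    field_simp
  convert! h.exp using 1
  ring

theorem hasDerivAt_exp_fst (τ w y : ℝ) (hτ : τ ≠ 0) :
    HasDerivAt (fun τ => Real.exp (-(w - y) ^ 2 / (2 * τ)))
      ((w - y) ^ 2 / (2 * τ ^ 2) * Real.exp (-(w - y) ^ 2 / (2 * τ))) τ := by
  have h : HasDerivAt (fun τ => -(w - y) ^ 2 / (2 * τ)) ((w - y) ^ 2 / (2 * τ ^ 2)) τ := by
    have := (hasDerivAt_const τ (-(w - y) ^ 2)).div ((hasDerivAt_id τ).const_mul 2)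
      (by simpa using hτ)
    convert! this using 1
    simp
    field_simp
  convert! h.exp using 1
  ring

theorem hasDerivAt_gaussMoment_zero_snd (hF : GaussIntegrable F Q) {τ : ℝ} (hτ : 0 < τ)
    (hτQ : τ ≤ Q) (y : ℝ) :
    HasDerivAt (fun y => gaussMoment F 0 τ y) (gaussMoment F 1 τ y / τ) y := by
  have h := hasDerivAt_integral_of_dominated_loc_of_deriv_le
    (F := fun y w => F w * ((w - y) ^ 0 * Real.exp (-(w - y) ^ 2 / (2 * τ))))
    (F' := fun y w => F w * ((w - y) ^ 1 * Real.exp (-(w - y) ^ 2 / (2 * τ))) / τ)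
    (bound := fun w => ‖F w‖ * gaussBound Q (|y| + 1) 1 w / τ)
    (μ := volume) (x₀ := y) (s := Metric.ball y 1) (Metric.ball_mem_nhds y one_pos)
    (Eventually.of_forall fun z => hF.aestronglyMeasurable_integrand 0 τ z)
    (hF.integrable_integrand hτ hτQ 0 y)
    ((hF.integrable_integrand hτ hτQ 1 y).div_const τ).aestronglyMeasurable
    (Eventually.of_forall fun w z hz => ?_) ((hF.integrable_bound _ 1).div_const τ)
    (Eventually.of_forall fun w z _ => ?_)
  · have := h.2
    rwa [integral_div] at this
  · rw [norm_div, Real.norm_of_nonneg hτ.le]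
    gcongr
    refine norm_integrand_le hτ hτQ ?_ 1 w
    rw [Metric.mem_ball, Real.dist_eq] at hz
    linarith [abs_sub_abs_le_abs_sub z y]
  · convert! ((hasDerivAt_exp_snd τ w z hτ.ne').const_mul 1).const_mul (F w) using 1
    simp
    ring

theorem hasDerivAt_gaussMoment_one_snd (hF : GaussIntegrable F Q) {τ : ℝ} (hτ : 0 < τ)
    (hτQ : τ ≤ Q) (y : ℝ) :
    HasDerivAt (fun y => gaussMoment F 1 τ y) (gaussMoment F 2 τ y / τ - gaussMoment F 0 τ y) y := by
  have i2 := (hF.integrable_integrand hτ hτQ 2 y).div_const τ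
  have i0 := hF.integrable_integrand hτ hτQ 0 y
  have h := hasDerivAt_integral_of_dominated_loc_of_deriv_le
    (F := fun y w => F w * ((w - y) ^ 1 * Real.exp (-(w - y) ^ 2 / (2 * τ))))
    (F' := fun y w => F w * ((w - y) ^ 2 * Real.exp (-(w - y) ^ 2 / (2 * τ))) / τ -
      F w * ((w - y) ^ 0 * Real.exp (-(w - y) ^ 2 / (2 * τ))))
    (bound := fun w => ‖F w‖ * gaussBound Q (|y| + 1) 2 w / τ +
      ‖F w‖ * gaussBound Q (|y| + 1) 0 w)
    (μ := volume) (x₀ := y) (s := Metric.ball y 1) (Metric.ball_mem_nhds y one_pos)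
    (Eventually.of_forall fun z => hF.aestronglyMeasurable_integrand 1 τ z)
    (hF.integrable_integrand hτ hτQ 1 y)
    (i2.sub i0).aestronglyMeasurable
    (Eventually.of_forall fun w z hz => ?_)
    (((hF.integrable_bound _ 2).div_const τ).add (hF.integrable_bound _ 0))
    (Eventually.of_forall fun w z _ => ?_)
  · have := h.2
    rwa [integral_sub i2 i0, integral_div] at this
  · have hz' : |z| ≤ |y| + 1 := by
      rw [Metric.mem_ball, Real.dist_eq] at hz
      linarith [abs_sub_abs_le_abs_sub z y]
    refine (norm_sub_le _ _).trans (add_le_add ?_ (norm_integrand_le hτ hτQ hz' 0 w))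
    rw [norm_div, Real.norm_of_nonneg hτ.le]
    gcongr
    exact norm_integrand_le hτ hτQ hz' 2 w
  · have h1 := (((hasDerivAt_id z).const_sub w).mul (hasDerivAt_exp_snd τ w z hτ.ne')).const_mul
      (F w)
    convert! h1 using 1
    · ext z; simp
    · simp; ring

/-- A two-sided derivative in `τ` needs domination on a neighbourhood of `τ`, and the bound stops at
`Q`; hence the strict inequality. Staying above τ/2 controls the factor 1/(2τ²). -/
theorem hasDerivAt_gaussMoment_zero_fst (hF : GaussIntegrable F Q) {τ : ℝ} (hτ : 0 < τ)
    (hτQ : τ < Q) (y : ℝ) :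
    HasDerivAt (fun τ => gaussMoment F 0 τ y) (gaussMoment F 2 τ y / (2 * τ ^ 2)) τ := by
  have h := hasDerivAt_integral_of_dominated_loc_of_deriv_le
    (F := fun τ w => F w * ((w - y) ^ 0 * Real.exp (-(w - y) ^ 2 / (2 * τ))))
    (F' := fun τ w => F w * ((w - y) ^ 2 * Real.exp (-(w - y) ^ 2 / (2 * τ))) / (2 * τ ^ 2))
    (bound := fun w => ‖F w‖ * gaussBound Q |y| 2 w / (2 * (τ / 2) ^ 2))
    (μ := volume) (x₀ := τ) (s := Ioo (τ / 2) Q) (Ioo_mem_nhds (by linarith) hτQ)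
    (Eventually.of_forall fun z => hF.aestronglyMeasurable_integrand 0 z y)
    (hF.integrable_integrand hτ hτQ.le 0 y)
    ((hF.integrable_integrand hτ hτQ.le 2 y).div_const _).aestronglyMeasurable
    (Eventually.of_forall fun w z hz => ?_) ((hF.integrable_bound _ 2).div_const _)
    (Eventually.of_forall fun w z hz => ?_)
  · have := h.2
    rwa [integral_div] at this
  · have hz0 : 0 < z := by linarith [hz.1]
    rw [norm_div, Real.norm_of_nonneg (by positivity : 0 ≤ 2 * z ^ 2)]
    gcongr
    · exact (norm_nonneg _).trans (norm_integrand_le hz0 hz.2.le le_rfl 2 w)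
    · exact norm_integrand_le hz0 hz.2.le le_rfl 2 w
    · exact hz.1.le
  · have hz0 : 0 < z := by linarith [hz.1]
    convert! ((hasDerivAt_exp_fst z w y hz0.ne').const_mul 1).const_mul (F w) using 1
    simp
    ring

end GaussIntegrable

/-- The normalisation `(2πτ)^(-1/2)` of the Gaussian density. -/
noncomputable def gaussNorm (τ : ℝ) : ℝ := (√(2 * Real.pi * τ))⁻¹

/-- The convolution of `F` with the centred Gaussian density of variance `τ`. -/
noncomputable def heat (F : ℝ → ℝ) (τ y : ℝ) : ℝ := gaussNorm τ * gaussMoment F 0 τ y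

/-- The first space derivative of `heat`. -/
noncomputable def heatD (F : ℝ → ℝ) (τ y : ℝ) : ℝ := gaussNorm τ * (gaussMoment F 1 τ y / τ)

/-- The second space derivative of `heat`. -/
noncomputable def heatDD (F : ℝ → ℝ) (τ y : ℝ) : ℝ :=
  gaussNorm τ * ((gaussMoment F 2 τ y / τ - gaussMoment F 0 τ y) / τ)

theorem gaussNorm_pos {τ : ℝ} (hτ : 0 < τ) : 0 < gaussNorm τ := by
  unfold gaussNorm; positivity

theorem hasDerivAt_gaussNorm {τ : ℝ} (hτ : 0 < τ) :
    HasDerivAt gaussNorm (-gaussNorm τ / (2 * τ)) τ := by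
  have hpos : 0 < 2 * Real.pi * τ := by positivity
  have h := (((hasDerivAt_id τ).const_mul (2 * Real.pi)).sqrt (by simpa using hpos.ne')).inv
    (by simpa using (Real.sqrt_pos.2 hpos).ne')
  convert! h using 1
  simp only [gaussNorm, id]
  have hs : √(2 * Real.pi * τ) ≠ 0 := (Real.sqrt_pos.2 hpos).ne'
  have hs2 : √(2 * Real.pi * τ) ^ 2 = 2 * Real.pi * τ := Real.sq_sqrt hpos.le
  rw [hs2]
  have := Real.pi_pos.ne'
  field_simp

theorem continuousOn_gaussNorm : ContinuousOn gaussNorm (Ioi 0) := fun _ hτ =>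
  (hasDerivAt_gaussNorm hτ).continuousAt.continuousWithinAt

namespace GaussIntegrable

variable {F : ℝ → ℝ} {Q : ℝ}

theorem continuousOn_gaussNorm_fst :
    ContinuousOn (fun a : ℝ × ℝ => gaussNorm a.1) (Ioc 0 Q ×ˢ univ) :=
  continuousOn_gaussNorm.comp continuousOn_fst fun _ ha => ha.1.1

theorem continuousOn_heat (hF : GaussIntegrable F Q) :
    ContinuousOn (fun a : ℝ × ℝ => heat F a.1 a.2) (Ioc 0 Q ×ˢ univ) :=
  continuousOn_gaussNorm_fst.mul (hF.continuousOn_gaussMoment 0)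

theorem continuousOn_heatD (hF : GaussIntegrable F Q) :
    ContinuousOn (fun a : ℝ × ℝ => heatD F a.1 a.2) (Ioc 0 Q ×ˢ univ) :=
  continuousOn_gaussNorm_fst.mul
    ((hF.continuousOn_gaussMoment 1).div continuousOn_fst fun _ ha => ha.1.1.ne')

theorem continuousOn_heatDD (hF : GaussIntegrable F Q) :
    ContinuousOn (fun a : ℝ × ℝ => heatDD F a.1 a.2) (Ioc 0 Q ×ˢ univ) :=
  continuousOn_gaussNorm_fst.mul
    ((((hF.continuousOn_gaussMoment 2).div continuousOn_fst fun _ ha => ha.1.1.ne').sub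
      (hF.continuousOn_gaussMoment 0)).div continuousOn_fst fun _ ha => ha.1.1.ne')

theorem hasDerivAt_heat (hF : GaussIntegrable F Q) {τ : ℝ} (hτ : τ ∈ Ioc 0 Q) (y : ℝ) :
    HasDerivAt (fun y => heat F τ y) (heatD F τ y) y :=
  (hF.hasDerivAt_gaussMoment_zero_snd hτ.1 hτ.2 y).const_mul _

theorem hasDerivAt_heatD (hF : GaussIntegrable F Q) {τ : ℝ} (hτ : τ ∈ Ioc 0 Q) (y : ℝ) :
    HasDerivAt (fun y => heatD F τ y) (heatDD F τ y) y :=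
  ((hF.hasDerivAt_gaussMoment_one_snd hτ.1 hτ.2 y).div_const τ).const_mul _

/-- The heat equation. -/
theorem hasDerivAt_heat_fst (hF : GaussIntegrable F Q) {τ : ℝ} (hτ : τ ∈ Ioo 0 Q) (y : ℝ) :
    HasDerivAt (fun τ => heat F τ y) (heatDD F τ y / 2) τ := by
  have h := (hasDerivAt_gaussNorm hτ.1).mul (hF.hasDerivAt_gaussMoment_zero_fst hτ.1 hτ.2 y)
  convert! h using 1
  have := hτ.1.ne'
  simp only [heatDD]
  field_simp
  ring

end GaussIntegrable

/-! ### Short time behaviour of Gaussian convolutions -/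

theorem integrable_exp_neg_sub_sq {τ : ℝ} (hτ : 0 < τ) (y : ℝ) :
    Integrable fun w => Real.exp (-(w - y) ^ 2 / (2 * τ)) := by
  have h := (integrable_exp_neg_mul_sq (b := (2 * τ)⁻¹) (by positivity)).comp_sub_right y
  refine h.congr (Eventually.of_forall fun w => ?_)
  simp only
  congr 1
  field_simp

theorem gaussNorm_mul_integral {τ : ℝ} (hτ : 0 < τ) (y : ℝ) :
    gaussNorm τ * ∫ w, Real.exp (-(w - y) ^ 2 / (2 * τ)) = 1 := by
  have h := integral_gaussian (2 * τ)⁻¹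
  rw [← integral_sub_right_eq_self _ y] at h
  have h' : (fun w => Real.exp (-(w - y) ^ 2 / (2 * τ))) =
      fun w => Real.exp (-(2 * τ)⁻¹ * (w - y) ^ 2) := by
    ext w; congr 1; field_simp
  rw [h', h, gaussNorm, show Real.pi / (2 * τ)⁻¹ = 2 * Real.pi * τ by field_simp]
  exact inv_mul_cancel₀ (Real.sqrt_pos.2 (by positivity)).ne'

theorem gaussNorm_mul_self_le {τ : ℝ} (hτ : 0 < τ) : gaussNorm τ * τ ≤ √τ := by
  have h1 : √τ ≤ √(2 * Real.pi * τ) := by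
    apply Real.sqrt_le_sqrt
    nlinarith [Real.pi_gt_three]
  have h2 : 0 < √τ := Real.sqrt_pos.2 hτ
  rw [gaussNorm, inv_mul_eq_div, div_le_iff₀ (h2.trans_le h1)]
  calc τ = √τ * √τ := (Real.mul_self_sqrt hτ.le).symm
    _ ≤ _ := by gcongr

/-- After subtracting `F y₀`, the part near `y₀` contributes at most `ε`. The far part is a Gaussian
tail, compared with the fixed variance `Q` because `F` may be unbounded. -/
theorem GaussIntegrable.tendsto_heat {F : ℝ → ℝ} {Q : ℝ} (hF : GaussIntegrable F Q) (hQ : 0 < Q)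
    {y₀ : ℝ} (hc : ContinuousAt F y₀) :
    Tendsto (fun a : ℝ × ℝ => heat F a.1 a.2) (𝓝[>] 0 ×ˢ 𝓝 y₀) (𝓝 (F y₀)) := by
  set G : ℝ → ℝ := fun w => F w - F y₀ with hGdef
  have hG : GaussIntegrable G Q := fun y => by
    refine ((hF y).sub ((integrable_exp_neg_sub_sq hQ y).const_mul (F y₀))).congr
      (Eventually.of_forall fun w => ?_)
    simp only [Pi.sub_apply, hGdef]
    ring
  refine tendsto_of_forall_eventually_abs_sub_le 2 fun ε hε => ?_
  obtain ⟨δ, hδ, hδε⟩ := Metric.continuousAt_iff.1 hc ε hε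
  set M := ∫ w, ‖G w‖ * gaussBound Q (|y₀| + δ) 0 w with hM
  set C := Real.exp (δ ^ 2 / (8 * Q)) * (8 / δ ^ 2) * M with hC
  have hM0 : 0 ≤ M := integral_nonneg fun w => mul_nonneg (norm_nonneg _)
    (by unfold gaussBound; positivity)
  have hsqrt : Tendsto (fun τ : ℝ => √τ * C) (𝓝[>] 0) (𝓝 0) := by
    have : Tendsto (fun τ : ℝ => √τ * C) (𝓝 0) (𝓝 (√0 * C)) :=
      (Real.continuous_sqrt.mul continuous_const).tendsto 0
    rw [Real.sqrt_zero, zero_mul] at this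
    exact this.mono_left nhdsWithin_le_nhds
  have h1 : ∀ᶠ τ in 𝓝[>] (0 : ℝ), 0 < τ ∧ τ ≤ Q ∧ √τ * C ≤ ε := by
    filter_upwards [self_mem_nhdsWithin, mem_nhdsWithin_of_mem_nhds (Iio_mem_nhds hQ),
      hsqrt.eventually_le_const hε] with τ h1 h2 h3
    exact ⟨h1, le_of_lt h2, h3⟩
  have h2 : ∀ᶠ y in 𝓝 y₀, |y - y₀| < δ / 2 := by
    exact Metric.eventually_nhds_iff.2 ⟨δ / 2, by positivity, fun y h => h⟩
  filter_upwards [h1.prod_mk h2] with ⟨τ, y⟩ ⟨⟨hτ, hτQ, hτε⟩, hy⟩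
  simp only at hτ hτQ hτε hy ⊢
  have hyR : |y| ≤ |y₀| + δ := by linarith [abs_sub_abs_le_abs_sub y y₀]
  set E : ℝ → ℝ := fun w => Real.exp (-(w - y) ^ 2 / (2 * τ)) with hE
  have hEi : Integrable E := integrable_exp_neg_sub_sq hτ y
  have hN := gaussNorm_pos hτ
  have iF := hF.integrable_integrand hτ hτQ 0 y
  have iG := hG.integrable_integrand hτ hτQ 0 y
  -- For |w - y| ≥ δ/2 the weight of variance `τ` is at most `κ` times that of variance `Q`. The
  -- distance δ/2 remains because `y` is within δ/2 of `y₀`.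
  set κ := Real.exp (δ ^ 2 / (8 * Q)) * Real.exp (-(δ ^ 2 / (8 * τ))) with hκ
  have hpt : ∀ w, ‖G w * ((w - y) ^ 0 * Real.exp (-(w - y) ^ 2 / (2 * τ)))‖ ≤
      ε * E w + κ * (‖G w‖ * gaussBound Q (|y₀| + δ) 0 w) := by
    intro w
    have hb : 0 ≤ gaussBound Q (|y₀| + δ) 0 w := by unfold gaussBound; positivity
    have hκ0 : 0 ≤ κ := by positivity
    rw [pow_zero, one_mul, norm_mul, Real.norm_of_nonneg (Real.exp_pos _).le]
    rcases lt_or_ge (dist w y₀) δ with h | h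
    · have := (hδε h).le
      rw [Real.dist_eq] at this
      have h3 : ‖G w‖ ≤ ε := this
      have : 0 ≤ κ * (‖G w‖ * gaussBound Q (|y₀| + δ) 0 w) := by positivity
      have h4 : ‖G w‖ * E w ≤ ε * E w := by
        have := (Real.exp_pos (-(w - y) ^ 2 / (2 * τ))).le
        gcongr
      linarith
    · have hwy : δ / 2 ≤ |w - y| := by
        rw [Real.dist_eq] at h
        have := abs_sub_le w y y₀
        linarith
      have hsq : δ ^ 2 / 4 ≤ (w - y) ^ 2 := by
        rw [← sq_abs (w - y)]
        nlinarith [abs_nonneg (w - y)]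
      have hexp : Real.exp (-(w - y) ^ 2 / (2 * τ)) ≤
          κ * ((w - y) ^ 0 * Real.exp (-(w - y) ^ 2 / (2 * Q))) := by
        rw [pow_zero, one_mul, hκ, ← Real.exp_add, ← Real.exp_add, Real.exp_le_exp]
        have hinv : 0 ≤ 1 / τ - 1 / Q := sub_nonneg.2 (one_div_le_one_div_of_le hτ hτQ)
        have := mul_nonneg (sub_nonneg.2 hsq) hinv
        have e1 : -(w - y) ^ 2 / (2 * τ) = -(w - y) ^ 2 * (1 / τ) / 2 := by ring
        have e2 : -(w - y) ^ 2 / (2 * Q) = -(w - y) ^ 2 * (1 / Q) / 2 := by ring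
        have e3 : δ ^ 2 / (8 * Q) = δ ^ 2 / 4 * (1 / Q) / 2 := by ring
        have e4 : δ ^ 2 / (8 * τ) = δ ^ 2 / 4 * (1 / τ) / 2 := by ring
        rw [e1, e2, e3, e4]
        nlinarith
      have hbd := (le_abs_self _).trans (abs_pow_mul_exp_le_gaussBound hQ le_rfl hyR 0 w)
      calc ‖G w‖ * Real.exp (-(w - y) ^ 2 / (2 * τ))
          ≤ ‖G w‖ * (κ * gaussBound Q (|y₀| + δ) 0 w) := by
            gcongr
            exact hexp.trans (mul_le_mul_of_nonneg_left hbd hκ0)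
        _ = 0 + κ * (‖G w‖ * gaussBound Q (|y₀| + δ) 0 w) := by ring
        _ ≤ _ := by
            gcongr
            have := (Real.exp_pos (-(w - y) ^ 2 / (2 * τ))).le
            positivity
  have hsub : heat F τ y - F y₀ = gaussNorm τ * gaussMoment G 0 τ y := by
    have h3 : gaussMoment G 0 τ y = gaussMoment F 0 τ y - F y₀ * ∫ w, E w := by
      rw [gaussMoment, gaussMoment, ← integral_const_mul, ← integral_sub iF (hEi.const_mul _)]
      congr 1 with w
      simp only [hGdef, hE]
      ring
    rw [h3, heat, mul_sub]
    have := gaussNorm_mul_integral hτ y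
    rw [mul_left_comm, this, mul_one]
  have hint : |gaussMoment G 0 τ y| ≤ ε * (∫ w, E w) + κ * M := by
    rw [hM, ← integral_const_mul, ← integral_const_mul,
      ← integral_add (hEi.const_mul ε) ((hG.integrable_bound _ 0).const_mul κ), ← Real.norm_eq_abs]
    exact norm_integral_le_of_norm_le
      ((hEi.const_mul ε).add ((hG.integrable_bound _ 0).const_mul κ)) (Eventually.of_forall hpt)
  -- A bound linear in `τ` suffices: it beats the normalisation, which grows only like τ^(-1/2).
  have hκle : κ ≤ Real.exp (δ ^ 2 / (8 * Q)) * (8 / δ ^ 2) * τ := by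
    have hx : 0 < δ ^ 2 / (8 * τ) := by positivity
    have h3 : Real.exp (-(δ ^ 2 / (8 * τ))) ≤ (δ ^ 2 / (8 * τ))⁻¹ := by
      rw [Real.exp_neg]
      exact inv_anti₀ hx ((by linarith : δ ^ 2 / (8 * τ) ≤ δ ^ 2 / (8 * τ) + 1).trans
        (Real.add_one_le_exp _))
    calc κ ≤ Real.exp (δ ^ 2 / (8 * Q)) * (δ ^ 2 / (8 * τ))⁻¹ := by rw [hκ]; gcongr
      _ = _ := by field_simp
  rw [hsub, abs_mul, abs_of_pos hN]
  calc gaussNorm τ * |gaussMoment G 0 τ y|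
      ≤ gaussNorm τ * (ε * (∫ w, E w) + κ * M) := by gcongr
    _ = ε * (gaussNorm τ * ∫ w, E w) + gaussNorm τ * (κ * M) := by ring
    _ ≤ ε * 1 + gaussNorm τ * ((Real.exp (δ ^ 2 / (8 * Q)) * (8 / δ ^ 2) * τ) * M) := by
        rw [gaussNorm_mul_integral hτ y]; gcongr
    _ = ε + (gaussNorm τ * τ) * C := by rw [hC]; ring
    _ ≤ ε + √τ * C := by
        gcongr
        exact gaussNorm_mul_self_le hτ
    _ ≤ 2 * ε := by linarith

/-! ### The value function as a Gaussian convolution -/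

section Value

variable {T : ℝ} {K : ℝ → ℝ → ℝ} {m : StieltjesFunction ℝ} {f : ℝ → ℝ}

/-- This is the substitution w = √τ z + log x - τ/2, turning the lognormal integral into a Gaussian
one of variance τ in the logarithmic price. -/
theorem valueIntegrand_eq {t x : ℝ} (hτ : 0 < qSqBetween K m t T) (hx : 0 < x) (z : ℝ) :
    valueIntegrand T K m f t x z = (fun w => (√(2 * Real.pi))⁻¹ * (f (Real.exp w) *
      Real.exp (-(w - (Real.log x - qSqBetween K m t T / 2)) ^ 2 / (2 * qSqBetween K m t T))))
      (√(qSqBetween K m t T) * z + (Real.log x - qSqBetween K m t T / 2)) := by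
  set τ := qSqBetween K m t T with hτdef
  have h1 : Real.exp (√τ * z + (Real.log x - τ / 2)) = x * Real.exp (-τ / 2 + √τ * z) := by
    rw [show √τ * z + (Real.log x - τ / 2) = Real.log x + (-τ / 2 + √τ * z) by ring,
      Real.exp_add, Real.exp_log hx]
  simp only [h1, add_sub_cancel_right, mul_pow, Real.sq_sqrt hτ.le]
  rw [valueIntegrand, qBetween, ← hτdef, gaussianPDFReal_def]
  simp only [NNReal.coe_one, mul_one, sub_zero]
  rw [show -(τ * z ^ 2) / (2 * τ) = -z ^ 2 / 2 by field_simp]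
  ring

theorem integrable_valueIntegrand_iff {t x : ℝ} (hτ : 0 < qSqBetween K m t T) (hx : 0 < x) :
    Integrable (valueIntegrand T K m f t x) ↔ Integrable fun w => f (Real.exp w) *
      Real.exp (-(w - (Real.log x - qSqBetween K m t T / 2)) ^ 2 / (2 * qSqBetween K m t T)) := by
  set g := (fun w => (√(2 * Real.pi))⁻¹ * (f (Real.exp w) *
      Real.exp (-(w - (Real.log x - qSqBetween K m t T / 2)) ^ 2 / (2 * qSqBetween K m t T))))
    with hg
  have h1 : valueIntegrand T K m f t x =
      fun z => g (√(qSqBetween K m t T) * z + (Real.log x - qSqBetween K m t T / 2)) :=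
    funext (valueIntegrand_eq hτ hx)
  have h2 (c : ℝ) : Integrable (fun w => g (w + c)) ↔ Integrable g :=
    ⟨fun h => by simpa using h.comp_sub_right c, fun h => h.comp_add_right c⟩
  rw [h1, integrable_comp_mul_left_iff
    (fun w => g (w + (Real.log x - qSqBetween K m t T / 2))) (Real.sqrt_pos.2 hτ).ne', h2, hg, integrable_const_mul_iff]
  exact (inv_pos.2 (Real.sqrt_pos.2 (by positivity))).ne'.isUnit

theorem value_eq_heat {t x : ℝ} (hτ : 0 < qSqBetween K m t T) (hx : 0 < x) :
    value T K m f t x = heat (fun w => f (Real.exp w)) (qSqBetween K m t T)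
      (Real.log x - qSqBetween K m t T / 2) := by
  rw [value, heat, gaussMoment]
  simp only [valueIntegrand_eq hτ hx]
  rw [Measure.integral_comp_mul_left (fun w => (fun w => (√(2 * Real.pi))⁻¹ * (f (Real.exp w) *
      Real.exp (-(w - (Real.log x - qSqBetween K m t T / 2)) ^ 2 / (2 * qSqBetween K m t T))))
      (w + (Real.log x - qSqBetween K m t T / 2))),
    integral_add_right_eq_self (fun w => (√(2 * Real.pi))⁻¹ * (f (Real.exp w) *
      Real.exp (-(w - (Real.log x - qSqBetween K m t T / 2)) ^ 2 / (2 * qSqBetween K m t T)))),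
    integral_const_mul, smul_eq_mul, gaussNorm, Real.sqrt_mul (by positivity : 0 ≤ 2 * Real.pi), mul_inv,
    abs_of_pos (inv_pos.2 (Real.sqrt_pos.2 hτ))]
  simp only [pow_zero, one_mul]
  ring

/-- No variance remains at T, so the integrand is the constant `f x` times a probability density. -/
theorem value_terminal (x : ℝ) : value T K m f T x = f x := by
  simp only [value, valueIntegrand, qBetween, qSqBetween, sub_self, neg_zero, zero_div,
    Real.sqrt_zero, zero_mul, add_zero, Real.exp_zero, mul_one]
  rw [integral_const_mul, integral_gaussianPDFReal_eq_one 0 one_ne_zero, mul_one]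

theorem integrable_valueIntegrand_terminal (x : ℝ) : Integrable (valueIntegrand T K m f T x) := by
  have : valueIntegrand T K m f T x = fun z => f x * gaussianPDFReal 0 1 z := by
    ext z
    simp [valueIntegrand, qBetween, qSqBetween]
  rw [this]
  exact (integrable_gaussianPDFReal 0 1).const_mul _

/-- Every centre `y` occurs as log x - q²(0,T)/2 for some x > 0, namely x = exp(y + q²(0,T)/2). -/
theorem gaussIntegrable_payoff (hQ : 0 < qSqBetween K m 0 T)
    (hf : ∀ x > 0, Integrable (valueIntegrand T K m f 0 x)) :
    GaussIntegrable (fun w => f (Real.exp w)) (qSqBetween K m 0 T) := by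
  intro y
  have h := (integrable_valueIntegrand_iff hQ (Real.exp_pos _)).1
    (hf (Real.exp (y + qSqBetween K m 0 T / 2)) (Real.exp_pos _))
  simpa [Real.log_exp] using h

theorem integrable_valueIntegrand {t x : ℝ}
    (hF : GaussIntegrable (fun w => f (Real.exp w)) (qSqBetween K m 0 T))
    (hτ : qSqBetween K m t T ∈ Ioc 0 (qSqBetween K m 0 T)) (hx : 0 < x) :
    Integrable (valueIntegrand T K m f t x) := by
  rw [integrable_valueIntegrand_iff hτ.1 hx]
  simpa using hF.integrable_integrand hτ.1 hτ.2 0 (Real.log x - qSqBetween K m t T / 2)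

theorem hasDerivAt_value {t x : ℝ}
    (hF : GaussIntegrable (fun w => f (Real.exp w)) (qSqBetween K m 0 T))
    (hτ : qSqBetween K m t T ∈ Ioc 0 (qSqBetween K m 0 T)) (hx : 0 < x) :
    HasDerivAt (fun y => value T K m f t y) (heatD (fun w => f (Real.exp w)) (qSqBetween K m t T)
      (Real.log x - qSqBetween K m t T / 2) / x) x := by
  have h := (hF.hasDerivAt_heat hτ (Real.log x - qSqBetween K m t T / 2)).comp x
    ((Real.hasDerivAt_log hx.ne').sub_const _)
  rw [div_eq_mul_inv]
  refine h.congr_of_eventuallyEq ?_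
  filter_upwards [Ioi_mem_nhds hx] with y hy
  exact value_eq_heat hτ.1 hy

theorem delta_eq_heatD {t x : ℝ}
    (hF : GaussIntegrable (fun w => f (Real.exp w)) (qSqBetween K m 0 T))
    (hτ : qSqBetween K m t T ∈ Ioc 0 (qSqBetween K m 0 T)) (hx : 0 < x) :
    delta T K m f t x = heatD (fun w => f (Real.exp w)) (qSqBetween K m t T)
      (Real.log x - qSqBetween K m t T / 2) / x :=
  (hasDerivAt_value hF hτ hx).deriv

end Value

/-! ### A second order expansion of the convolution along the heat flow -/

/-- Here `e` counts as a second order quantity, like `d ^ 2`: the terms d³, d e and e² are all small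
multiples of `d ^ 2 + e`. -/
theorem abs_exp_sub_one_sub_sub_sq_le {d e η : ℝ} (he : 0 ≤ e) (hη : η ≤ 1 / 2) (hd : |d| ≤ η)
    (heη : e ≤ η) :
    |Real.exp (d - e / 2) - 1 - (d - e / 2) - d ^ 2 / 2| ≤ 2 * η * (d ^ 2 + e) := by
  have hd' := abs_le.1 hd
  have hη0 : 0 ≤ η := (abs_nonneg d).trans hd
  have hθ : |d - e / 2| ≤ 3 / 2 * η := by
    rw [abs_le]; constructor <;> linarith
  have h1 := Real.exp_bound (x := d - e / 2) (hθ.trans (by linarith)) (n := 3) (by norm_num)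
  have h2 : ∑ i ∈ Finset.range 3, (d - e / 2) ^ i / i.factorial =
      1 + (d - e / 2) + (d - e / 2) ^ 2 / 2 := by
    simp [Finset.sum_range_succ, Nat.factorial]
  rw [h2] at h1
  have h3 : |d - e / 2| ^ 3 * ((3 : ℕ).succ / ((3 : ℕ).factorial * (3 : ℕ)) : ℝ) ≤
      η * (d ^ 2 + e) := by
    have e1 : ((3 : ℕ).succ / ((3 : ℕ).factorial * (3 : ℕ)) : ℝ) = 2 / 9 := by
      norm_num [Nat.factorial]
    have e2 : |d - e / 2| ^ 3 ≤ 3 / 2 * η * (d - e / 2) ^ 2 := by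
      rw [pow_succ', sq_abs]
      gcongr
    have e3 : (d - e / 2) ^ 2 ≤ 2 * d ^ 2 + e := by
      nlinarith [sq_nonneg (d + e / 2)]
    rw [e1]
    calc |d - e / 2| ^ 3 * (2 / 9) ≤ 3 / 2 * η * (2 * d ^ 2 + e) * (2 / 9) := by
          gcongr
          exact e2.trans (by gcongr)
      _ ≤ η * (d ^ 2 + e) := by nlinarith [mul_nonneg hη0 (sq_nonneg d), mul_nonneg hη0 he]
  have h4 : |((d - e / 2) ^ 2 - d ^ 2) / 2| ≤ η * e := by
    rw [show ((d - e / 2) ^ 2 - d ^ 2) / 2 = e * ((e / 4 - d) / 2) by ring, abs_mul,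
      abs_of_nonneg he, mul_comm]
    gcongr
    rw [abs_le]; constructor <;> linarith
  have h5 : Real.exp (d - e / 2) - 1 - (d - e / 2) - d ^ 2 / 2 =
      (Real.exp (d - e / 2) - (1 + (d - e / 2) + (d - e / 2) ^ 2 / 2)) +
        ((d - e / 2) ^ 2 - d ^ 2) / 2 := by ring
  rw [h5]
  refine (abs_add_le _ _).trans ?_
  nlinarith [h1.trans h3, h4, mul_nonneg hη0 (sq_nonneg d)]

namespace GaussIntegrable

variable {F : ℝ → ℝ} {Q : ℝ}

/-- The mean value inequality is applied twice, first to `heatD` and then to `heat`. It gives `ε`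
where Taylor's formula would give ε/2. -/
theorem abs_heat_sub_sub_sub_le (hF : GaussIntegrable F Q) {τ : ℝ} (hτ : τ ∈ Ioc 0 Q) {y y' ε : ℝ}
    (h : ∀ z ∈ uIcc y y', |heatDD F τ z - heatDD F τ y| ≤ ε) :
    |heat F τ y' - heat F τ y - heatD F τ y * (y' - y) - heatDD F τ y / 2 * (y' - y) ^ 2| ≤
      ε * (y' - y) ^ 2 := by
  have hy : y ∈ uIcc y y' := left_mem_uIcc
  have h1 : ∀ z ∈ uIcc y y', |heatD F τ z - heatD F τ y - heatDD F τ y * (z - y)| ≤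
      ε * |y' - y| := by
    intro z hz
    have := (convex_uIcc y y').norm_image_sub_le_of_norm_hasDerivWithin_le
      (f := fun z => heatD F τ z - heatDD F τ y * z) (f' := fun z => heatDD F τ z - heatDD F τ y)
      (fun z _ => by
        have := (hF.hasDerivAt_heatD hτ z).sub ((hasDerivAt_id z).const_mul (heatDD F τ y))
        rw [mul_one] at this
        exact this.hasDerivWithinAt)
      (C := ε) h hy hz
    rw [Real.norm_eq_abs, Real.norm_eq_abs] at this
    have h2 : |z - y| ≤ |y' - y| := abs_sub_left_of_mem_uIcc hz
    have hε : 0 ≤ ε := (abs_nonneg _).trans (h y hy)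
    calc _ = |heatD F τ z - heatDD F τ y * z - (heatD F τ y - heatDD F τ y * y)| := by
          congr 1; ring
      _ ≤ ε * |z - y| := this
      _ ≤ _ := by gcongr
  have := (convex_uIcc y y').norm_image_sub_le_of_norm_hasDerivWithin_le
    (f := fun z => heat F τ z - heatD F τ y * z - heatDD F τ y / 2 * (z - y) ^ 2)
    (f' := fun z => heatD F τ z - heatD F τ y - heatDD F τ y * (z - y))
    (fun z _ => by
      have := ((hF.hasDerivAt_heat hτ z).sub ((hasDerivAt_id z).const_mul (heatD F τ y))).sub
        ((((hasDerivAt_id z).sub_const y).pow 2).const_mul (heatDD F τ y / 2))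
      refine HasDerivAt.hasDerivWithinAt ?_
      convert! this using 1
      simp
      ring)
    (C := ε * |y' - y|) h1 hy right_mem_uIcc
  rw [Real.norm_eq_abs, Real.norm_eq_abs, mul_assoc, abs_mul_abs_self, ← sq] at this
  convert this using 2
  ring

/-- The heat equation turns the time slope into half of `heatDD` at an intermediate variance. The
mean value theorem needs the derivative only in the open interval, so `τ = Q` is admitted. -/
theorem abs_heat_sub_add_le (hF : GaussIntegrable F Q) {τ τ' y c ε : ℝ} (hτ' : 0 < τ')
    (hττ : τ' ≤ τ) (hτ : τ ≤ Q) (h : ∀ s ∈ Icc τ' τ, |heatDD F s y - c| ≤ ε) :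
    |heat F τ' y - heat F τ y + c / 2 * (τ - τ')| ≤ ε / 2 * (τ - τ') := by
  rcases hττ.eq_or_lt with rfl | hlt
  · simp
  obtain ⟨s, hs, hs'⟩ := exists_hasDerivAt_eq_slope (fun τ => heat F τ y)
    (fun τ => heatDD F τ y / 2) hlt
    (hF.continuousOn_heat.comp (continuousOn_id.prodMk continuousOn_const)
      fun r hr => ⟨⟨hτ'.trans_le hr.1, hr.2.trans hτ⟩, mem_univ _⟩)
    (fun r hr => hF.hasDerivAt_heat_fst ⟨hτ'.trans hr.1, hr.2.trans_le hτ⟩ y)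
  rw [eq_div_iff (by linarith)] at hs'
  have h1 : heat F τ' y - heat F τ y + c / 2 * (τ - τ') =
      -((heatDD F s y - c) / 2 * (τ - τ')) := by
    linear_combination hs'
  rw [h1, abs_neg, abs_mul, abs_of_pos (by linarith : 0 < τ - τ'), abs_div, abs_two]
  gcongr
  exact h s ⟨hs.1.le, hs.2.le⟩

/-- Expansion of `heat F` to first order in time and second order in space, uniformly on compact
sets. The hedge `heatD F τ y * (exp(y' - y + (τ' - τ)/2) - 1)` is compared with the increment of
the value. -/
theorem exists_abs_heat_increment_sub_le (hF : GaussIntegrable F Q) {τ₀ : ℝ} (R : ℝ)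
    (hτ₀ : 0 < τ₀) {ε : ℝ} (hε : 0 < ε) :
    ∃ η > 0, ∀ τ ∈ Icc τ₀ Q, ∀ τ' ∈ Icc τ₀ Q, τ' ≤ τ → ∀ y ∈ Icc (-R) R, ∀ y' ∈ Icc (-R) R,
      |y' - y| < η → τ - τ' < η →
      |heat F τ' y' - heat F τ y - heatD F τ y * (Real.exp (y' - y - (τ - τ') / 2) - 1) -
        (heatDD F τ y - heatD F τ y) / 2 * ((y' - y) ^ 2 - (τ - τ'))| ≤
      ε * ((y' - y) ^ 2 + (τ - τ')) := by
  have hsub : Icc τ₀ Q ×ˢ Icc (-R) R ⊆ Ioc 0 Q ×ˢ (univ : Set ℝ) := fun a ha =>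
    ⟨⟨hτ₀.trans_le ha.1.1, ha.1.2⟩, mem_univ _⟩
  have hcomp : IsCompact (Icc τ₀ Q ×ˢ Icc (-R) R) := isCompact_Icc.prod isCompact_Icc
  obtain ⟨M, hM⟩ := hcomp.exists_bound_of_continuousOn (hF.continuousOn_heatD.mono hsub)
  have huc := hcomp.uniformContinuousOn_of_continuous (hF.continuousOn_heatDD.mono hsub)
  rw [Metric.uniformContinuousOn_iff] at huc
  obtain ⟨δ, hδ, hδε⟩ := huc (ε / 2) (by positivity)
  -- `δ` controls the oscillation of `heatDD`, 1/2 is required by the exponential expansion, and the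
  -- last entry absorbs the bound `M` on `heatD`.
  set η := min (min δ (1 / 2)) (ε / (4 * (|M| + 1))) with hη
  have hη0 : 0 < η := by positivity
  refine ⟨η, hη0, fun τ hτ τ' hτ' hττ y hy y' hy' hd he => ?_⟩
  have hηδ : η ≤ δ := (min_le_left _ _).trans (min_le_left _ _)
  have hη2 : η ≤ 1 / 2 := (min_le_left _ _).trans (min_le_right _ _)
  have hηM : |M| * (2 * η) ≤ ε / 2 := by
    have : η * (4 * (|M| + 1)) ≤ ε := by
      rw [← le_div_iff₀ (by positivity)]
      exact min_le_right _ _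
    nlinarith [abs_nonneg M]
  have he0 : 0 ≤ τ - τ' := by linarith
  have p1 := hF.abs_heat_sub_sub_sub_le (τ := τ) ⟨hτ₀.trans_le hτ.1, hτ.2⟩ (y := y) (y' := y')
    (ε := ε / 2) fun z hz => by
      have hz' : z ∈ Icc (-R) R := (uIcc_subset_Icc hy hy') hz
      have := hδε (τ, z) ⟨hτ, hz'⟩ (τ, y) ⟨hτ, hy⟩ (by
        rw [Prod.dist_eq, dist_self, Real.dist_eq]
        exact max_lt hδ ((abs_sub_left_of_mem_uIcc hz).trans_lt (hd.trans_le hηδ)))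
      rw [Real.dist_eq] at this
      exact this.le
  -- The increment is split into a space step at variance `τ` and a time step at `y'`; both are
  -- compared with `heatDD F τ y`.
  have p2 := hF.abs_heat_sub_add_le (τ := τ) (τ' := τ') (y := y') (c := heatDD F τ y)
    (ε := ε / 2) (hτ₀.trans_le hτ'.1) hττ hτ.2 fun s hs => by
      have := hδε (s, y') ⟨⟨hτ'.1.trans hs.1, hs.2.trans hτ.2⟩, hy'⟩ (τ, y) ⟨hτ, hy⟩ (by
        rw [Prod.dist_eq, Real.dist_eq, Real.dist_eq]
        refine max_lt ?_ (hd.trans_le hηδ)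
        rw [abs_sub_comm, abs_of_nonneg (by linarith [hs.2])]
        linarith [hs.1])
      rw [Real.dist_eq] at this
      exact this.le
  have p3 := abs_exp_sub_one_sub_sub_sq_le he0 hη2 hd.le he.le
  have p4 : |heatD F τ y * (Real.exp (y' - y - (τ - τ') / 2) - 1 - (y' - y - (τ - τ') / 2) -
      (y' - y) ^ 2 / 2)| ≤ ε / 2 * ((y' - y) ^ 2 + (τ - τ')) := by
    rw [abs_mul]
    calc _ ≤ |M| * (2 * η * ((y' - y) ^ 2 + (τ - τ'))) := by
          exact mul_le_mul ((hM (τ, y) ⟨hτ, hy⟩).trans (le_abs_self M)) p3 (abs_nonneg _)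
            (abs_nonneg _)
      _ = |M| * (2 * η) * ((y' - y) ^ 2 + (τ - τ')) := by ring
      _ ≤ _ := by gcongr
  rw [abs_le] at p1 p2 p4 ⊢
  constructor <;> nlinarith [p1.1, p1.2, p2.1, p2.2, p4.1, p4.2]

end GaussIntegrable

/-! ### Weighted sums along partitions -/

theorem exists_timePartition_mesh_lt {t δ : ℝ} (ht : 0 < t) (hδ : 0 < δ) :
    ∃ g : TimePartition t, ∀ k < g.n, g.pt (k + 1) - g.pt k < δ := by
  obtain ⟨N, hN⟩ := exists_nat_gt (t / δ)
  have hN0 : (0 : ℝ) < N := (by positivity : 0 < t / δ).trans hN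
  refine ⟨⟨N, fun i => i * (t / N), by simp, by field_simp, fun k _ => ?_⟩, fun k _ => ?_⟩
  · have : (0 : ℝ) < t / N := by positivity
    push_cast
    nlinarith
  · rw [div_lt_comm₀ hδ hN0] at hN
    push_cast
    linarith

/-- If the measures `∑ₖ aₖ δ_{t_{k+1}}` on `[0, t]` have bounded total variation and distribution
functions tending to `0`, then their integrals against continuous functions tend to `0`. -/
theorem tendsto_weightedSum_zero {T : ℝ} {p : ℕ → TimePartition T} (hp : MeshTendsToZero p)
    {t : ℝ} (ht : t ∈ Icc 0 T) {a : ℕ → ℕ → ℝ} {C : ℝ}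
    (hC : ∀ᶠ j in atTop,
      ∑ k ∈ (Finset.range (p j).n).filter (fun k => (p j).pt (k + 1) ≤ t), |a j k| ≤ C)
    (ha : ∀ s ∈ Icc 0 t, Tendsto (fun j =>
      ∑ k ∈ (Finset.range (p j).n).filter (fun k => (p j).pt (k + 1) ≤ s), a j k) atTop (𝓝 0))
    {h : ℝ → ℝ} (hh : ContinuousOn h (Icc 0 t)) :
    Tendsto (fun j => ∑ k ∈ (Finset.range (p j).n).filter (fun k => (p j).pt (k + 1) ≤ t),
      h ((p j).pt k) * a j k) atTop (𝓝 0) := by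
  rcases ht.1.eq_or_lt with rfl | ht0
  · refine tendsto_const_nhds.congr fun j => (Finset.sum_eq_zero fun k hk => ?_).symm
    rw [Finset.mem_filter, Finset.mem_range] at hk
    have h1 := (p j).pt_lt k hk.1
    have h2 := ((p j).pt_mem hk.1.le).1
    linarith [hk.2]
  -- The share `C` pays for replacing `h` by a step function, the 1 for the integral of that step
  -- function.
  refine tendsto_of_forall_eventually_abs_sub_le (C + 1) fun ε hε => ?_
  have huc := isCompact_Icc.uniformContinuousOn_of_continuous hh
  rw [Metric.uniformContinuousOn_iff] at huc
  obtain ⟨δ, hδ, hδε⟩ := huc ε hε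
  -- Half of `δ` goes to the coarse grid and half to the mesh of `p j`, since `h` is taken at t_k
  -- but the step function at t_{k+1}.
  obtain ⟨g, hg⟩ := exists_timePartition_mesh_lt ht0 (half_pos hδ)
  set A : ℕ → ℝ → ℝ := fun j s =>
    ∑ k ∈ (Finset.range (p j).n).filter (fun k => (p j).pt (k + 1) ≤ s), a j k with hA
  -- Writing the step function with indicators of r ≤ g_i makes its weighted sum a finite
  -- combination of the distribution functions `A j`, with the grid `g` fixed as `j` grows.
  set step : ℝ → ℝ := fun r => ∑ i ∈ Finset.range g.n,
    h (g.pt i) * ((if r ≤ g.pt (i + 1) then 1 else 0) - (if r ≤ g.pt i then 1 else 0)) with hstep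
  have hstep_eq : ∀ i < g.n, ∀ r, g.pt i < r → r ≤ g.pt (i + 1) → step r = h (g.pt i) := by
    intro i hi r h1 h2
    simp only [hstep]
    rw [Finset.sum_eq_single i]
    · rw [if_pos h2, if_neg (not_le.2 h1)]; ring
    · intro l hl hli
      rw [Finset.mem_range] at hl
      rcases lt_or_gt_of_ne hli with hlt | hgt
      · have e1 := g.pt_mono (i := l + 1) (j := i) hlt hi.le
        have e2 := g.pt_mono (i := l) (j := i) hlt.le hi.le
        rw [if_neg (by linarith), if_neg (by linarith)]; ring
      · have e1 := g.pt_mono (i := i + 1) (j := l) hgt hl.le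
        have e2 := g.pt_mono (i := i + 1) (j := l + 1) (by omega) hl
        rw [if_pos (by linarith), if_pos (by linarith)]; ring
    · intro hi'; exact absurd (Finset.mem_range.2 hi) hi'
  have hstep_sum : ∀ j, ∑ i ∈ Finset.range g.n, h (g.pt i) * (A j (g.pt (i + 1)) - A j (g.pt i)) =
      ∑ k ∈ (Finset.range (p j).n).filter (fun k => (p j).pt (k + 1) ≤ t),
        step ((p j).pt (k + 1)) * a j k := by
    intro j
    -- The step function vanishes beyond `t`, so the restriction on the sum can be dropped.
    have e1 : ∀ k, (if (p j).pt (k + 1) ≤ t then step ((p j).pt (k + 1)) * a j k else 0) =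
        step ((p j).pt (k + 1)) * a j k := by
      intro k
      split_ifs with hk
      · rfl
      · have : step ((p j).pt (k + 1)) = 0 := Finset.sum_eq_zero fun i hi => by
          rw [Finset.mem_range] at hi
          have e1 := (g.pt_mem hi).2
          have e2 := (g.pt_mem hi.le).2
          rw [if_neg (by linarith), if_neg (by linarith)]; ring
        rw [this, zero_mul]
    rw [Finset.sum_filter, Finset.sum_congr rfl fun k _ => e1 k]
    simp only [hstep, hA, Finset.sum_filter, ← Finset.sum_sub_distrib, Finset.mul_sum,
      Finset.sum_mul]
    rw [Finset.sum_comm]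
    refine Finset.sum_congr rfl fun k _ => Finset.sum_congr rfl fun i _ => ?_
    split_ifs <;> ring
  have hlim : Tendsto (fun j => ∑ i ∈ Finset.range g.n,
      h (g.pt i) * (A j (g.pt (i + 1)) - A j (g.pt i))) atTop (𝓝 0) := by
    have : Tendsto (fun j => ∑ i ∈ Finset.range g.n,
        h (g.pt i) * (A j (g.pt (i + 1)) - A j (g.pt i))) atTop
        (𝓝 (∑ i ∈ Finset.range g.n, h (g.pt i) * (0 - 0))) := by
      refine tendsto_finsetSum _ fun i hi => ?_
      rw [Finset.mem_range] at hi
      exact ((ha _ (g.pt_mem hi)).sub (ha _ (g.pt_mem hi.le))).const_mul _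
    simpa using this
  filter_upwards [hC, hp (δ / 2) (half_pos hδ), Metric.tendsto_nhds.1 hlim ε hε] with j hCj hpj hj
  rw [Real.dist_eq, sub_zero, hstep_sum] at hj
  rw [sub_zero]
  set s := (Finset.range (p j).n).filter (fun k => (p j).pt (k + 1) ≤ t) with hs
  have hdiff : |∑ k ∈ s, h ((p j).pt k) * a j k - ∑ k ∈ s, step ((p j).pt (k + 1)) * a j k| ≤
      ε * C := by
    rw [← Finset.sum_sub_distrib]
    calc _ ≤ ∑ k ∈ s, |h ((p j).pt k) * a j k - step ((p j).pt (k + 1)) * a j k| :=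
          Finset.abs_sum_le_sum_abs _ _
      _ ≤ ∑ k ∈ s, ε * |a j k| := by
          refine Finset.sum_le_sum fun k hk => ?_
          rw [hs, Finset.mem_filter, Finset.mem_range] at hk
          have hlt := (p j).pt_lt k hk.1
          have h0 := ((p j).pt_mem hk.1.le).1
          obtain ⟨i, hi, hi1, hi2⟩ := g.exists_mem_Ioc (u := (p j).pt (k + 1)) ⟨by linarith, hk.2⟩
          rw [hstep_eq i hi _ hi1 hi2, ← sub_mul, abs_mul]
          have := hδε ((p j).pt k) ⟨h0, by linarith [hk.2]⟩ (g.pt i) (g.pt_mem hi.le) (by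
            have := hg i hi
            have := hpj k hk.1
            rw [Real.dist_eq, abs_lt]
            constructor <;> linarith)
          rw [Real.dist_eq] at this
          gcongr
      _ = ε * ∑ k ∈ s, |a j k| := by rw [Finset.mul_sum]
      _ ≤ ε * C := by gcongr
  rw [abs_le] at hdiff ⊢
  rw [abs_lt] at hj
  constructor <;> linarith [hj.1, hj.2, hdiff.1, hdiff.2]

/-! ### Pathwise integration along paths with quadratic variation -/

theorem TimePartition.sum_abs_sub_le {T : ℝ} (p : TimePartition T) {b : ℝ → ℝ}
    (hb : BoundedVariationOn b (Icc 0 T)) {N : ℕ} (hN : N ≤ p.n) :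
    ∑ k ∈ Finset.range N, |b (p.pt (k + 1)) - b (p.pt k)| ≤
      (eVariationOn b (Icc 0 T)).toReal := by
  have h := eVariationOn.sum_le_of_monotoneOn_Iic (f := b) (s := Icc 0 T) (n := N) (u := p.pt)
    (fun i _ j hj hij => p.pt_mono hij (hj.trans hN)) fun i hi => p.pt_mem (hi.trans hN)
  have h2 := ENNReal.toReal_mono hb h
  rw [ENNReal.toReal_sum fun i _ => edist_ne_top _ _] at h2
  refine le_trans (le_of_eq (Finset.sum_congr rfl fun k _ => ?_)) h2
  rw [edist_dist, ENNReal.toReal_ofReal dist_nonneg, Real.dist_eq]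

/-- Increments of a continuous function over `[t_N, t]` vanish with the mesh, where `t_N` is the
last partition point before `t`. -/
theorem tendsto_sum_increments {T : ℝ} {p : ℕ → TimePartition T} (hp : MeshTendsToZero p)
    {t : ℝ} (ht : t ∈ Icc 0 T) {g : ℝ → ℝ} (hg : ContinuousOn g (Icc 0 t)) :
    Tendsto (fun j => ∑ k ∈ (Finset.range (p j).n).filter (fun k => (p j).pt (k + 1) ≤ t),
      (g ((p j).pt (k + 1)) - g ((p j).pt k))) atTop (𝓝 (g t - g 0)) := by
  have hgt := hg t ⟨ht.1, le_rfl⟩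
  rw [Metric.continuousWithinAt_iff] at hgt
  refine Metric.tendsto_nhds.2 fun ε hε => ?_
  obtain ⟨δ, hδ, hδε⟩ := hgt ε hε
  filter_upwards [hp δ hδ] with j hj
  obtain ⟨N, hN, hNe, hNt, hN'⟩ := (p j).exists_filter_eq_range ht.1
  rw [hNe, Finset.sum_range_sub (fun k => g ((p j).pt k)), (p j).pt_zero, Real.dist_eq,
    sub_sub_sub_cancel_right, ← Real.dist_eq]
  refine hδε ⟨((p j).pt_mem hN).1, hNt⟩ ?_
  rw [Real.dist_eq, abs_sub_comm, abs_of_nonneg (by linarith)]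
  rcases hN.lt_or_eq with hlt | heq
  · linarith [hN' hlt, hj N hlt]
  · rw [heq, (p j).pt_last] at hNt ⊢
    linarith [ht.2]

/-- Pathwise change of variables: the forward sums of the delta hedge, written in terms of the
logarithmic price `c + b + x` and of the remaining variance `q(T) - q`, converge to the increment
of the value. -/
theorem tendsto_sum_heatD {T : ℝ} {F x b q : ℝ → ℝ} (c : ℝ)
    (hq : StrictMonoOn q (Icc 0 T)) (hqc : ContinuousOn q (Icc 0 T))
    (hF : GaussIntegrable F (q T - q 0))
    (hx : ContinuousOn x (Icc 0 T)) (hb : ContinuousOn b (Icc 0 T))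
    (hb' : BoundedVariationOn b (Icc 0 T))
    {p : ℕ → TimePartition T} (hp : MeshTendsToZero p)
    (hqv : HasPathwiseQuadraticVariation p x q) {t : ℝ} (ht : t ∈ Ico 0 T) :
    Tendsto (fun j => ∑ k ∈ (Finset.range (p j).n).filter (fun k => (p j).pt (k + 1) ≤ t),
      heatD F (q T - q ((p j).pt k)) (c + b ((p j).pt k) + x ((p j).pt k)) *
        (Real.exp (c + b ((p j).pt (k + 1)) + x ((p j).pt (k + 1)) -
          (c + b ((p j).pt k) + x ((p j).pt k)) -
          (q ((p j).pt (k + 1)) - q ((p j).pt k)) / 2) - 1)) atTop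
      (𝓝 (heat F (q T - q t) (c + b t + x t) - heat F (q T - q 0) (c + b 0 + x 0))) := by
  have hT : 0 < T := ht.1.trans_lt ht.2
  have ht' : t ∈ Icc 0 T := ⟨ht.1, ht.2.le⟩
  have hTT : T ∈ Icc 0 T := ⟨hT.le, le_rfl⟩
  have h0T : (0 : ℝ) ∈ Icc 0 T := ⟨le_rfl, hT.le⟩
  have hsub : Icc 0 t ⊆ Icc 0 T := Icc_subset_Icc_right ht.2.le
  have hmono := hq.monotoneOn
  set τ : ℝ → ℝ := fun s => q T - q s with hτ
  set Z : ℝ → ℝ := fun s => c + b s + x s with hZ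
  have hZc : ContinuousOn Z (Icc 0 T) := (continuousOn_const.add hb).add hx
  have hτc : ContinuousOn τ (Icc 0 T) := continuousOn_const.sub hqc
  have hτt : 0 < τ t := sub_pos.2 (hq ht' hTT ht.2)
  have hτmem : ∀ s ∈ Icc 0 t, τ s ∈ Icc (τ t) (q T - q 0) := fun s hs =>
    ⟨sub_le_sub_left (hmono (hsub hs) ht' hs.2) _,
      sub_le_sub_left (hmono h0T (hsub hs) hs.1) _⟩
  have hmaps : MapsTo (fun s => (τ s, Z s)) (Icc 0 t) (Ioc 0 (q T - q 0) ×ˢ univ) := fun s hs =>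
    ⟨⟨hτt.trans_le (hτmem s hs).1, (hτmem s hs).2⟩, mem_univ _⟩
  have hpair : ContinuousOn (fun s => (τ s, Z s)) (Icc 0 t) := (hτc.mono hsub).prodMk (hZc.mono hsub)
  -- This weight is what survives from the expansion: half of `heatDD` from the value, minus half of
  -- `heatD` from the exponential in the hedge.
  set h : ℝ → ℝ := fun s => (heatDD F (τ s) (Z s) - heatD F (τ s) (Z s)) / 2 with hh
  have hhc : ContinuousOn h (Icc 0 t) :=
    ((hF.continuousOn_heatDD.comp hpair hmaps).sub (hF.continuousOn_heatD.comp hpair hmaps)).div_const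
      2
  set U : ℝ → ℝ := fun s => heat F (τ s) (Z s) with hU
  have hUc : ContinuousOn U (Icc 0 t) := hF.continuousOn_heat.comp hpair hmaps
  obtain ⟨M, hM⟩ := isCompact_Icc.exists_bound_of_continuousOn hhc
  obtain ⟨R, hR⟩ := isCompact_Icc.exists_bound_of_continuousOn (hZc.mono hsub)
  -- the compensated squared increments
  set a : ℕ → ℕ → ℝ := fun j k => (x ((p j).pt (k + 1)) - x ((p j).pt k)) ^ 2 -
    (q ((p j).pt (k + 1)) - q ((p j).pt k)) with ha
  -- The quadratic sums at time 0 are empty.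
  have hq0 : q 0 = 0 := by
    refine tendsto_nhds_unique (hqv 0 h0T) (tendsto_const_nhds.congr fun j => ?_)
    refine (Finset.sum_eq_zero fun k hk => ?_).symm
    rw [Finset.mem_filter, Finset.mem_range] at hk
    have h1 := (p j).pt_lt k hk.1
    have h2 := ((p j).pt_mem hk.1.le).1
    linarith [hk.2]
  have hbounds : ∀ᶠ j in atTop, qvSum (p j) x t ≤ q t + 1 :=
    (hqv t ht').eventually_le_const (by linarith)
  have hqsum : ∀ j, ∑ k ∈ (Finset.range (p j).n).filter (fun k => (p j).pt (k + 1) ≤ t),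
      (q ((p j).pt (k + 1)) - q ((p j).pt k)) ≤ q t := by
    intro j
    obtain ⟨N, hN, hNe, hNt, -⟩ := (p j).exists_filter_eq_range ht.1
    rw [hNe, Finset.sum_range_sub (fun k => q ((p j).pt k)), (p j).pt_zero, hq0, sub_zero]
    exact hmono ((p j).pt_mem hN) ht' hNt
  have hqnn : ∀ j, ∀ k < (p j).n, 0 ≤ q ((p j).pt (k + 1)) - q ((p j).pt k) := fun j k hk =>
    sub_nonneg.2 (hmono ((p j).pt_mem hk.le) ((p j).pt_mem hk) ((p j).pt_lt k hk).le)
  have hweak : Tendsto (fun j =>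
      ∑ k ∈ (Finset.range (p j).n).filter (fun k => (p j).pt (k + 1) ≤ t),
        h ((p j).pt k) * a j k) atTop (𝓝 0) := by
    refine tendsto_weightedSum_zero hp ht' (C := q t + 1 + q t) ?_ ?_ hhc
    · filter_upwards [hbounds] with j hj
      refine le_trans ?_ (add_le_add hj (hqsum j))
      rw [qvSum, ← Finset.sum_add_distrib]
      refine Finset.sum_le_sum fun k hk => ?_
      rw [Finset.mem_filter, Finset.mem_range] at hk
      refine (abs_sub _ _).trans (le_of_eq ?_)
      rw [abs_of_nonneg (sq_nonneg _), abs_of_nonneg (hqnn j k hk.1)]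
    · intro s hs
      have := (hqv s (hsub hs)).sub (tendsto_sum_increments hp (hsub hs)
        (hqc.mono (Icc_subset_Icc_right (hsub hs).2)))
      rw [hq0, sub_zero, sub_self] at this
      refine this.congr fun j => ?_
      rw [qvSum, ← Finset.sum_sub_distrib]
  have htele := tendsto_sum_increments hp ht' hUc
  -- the remainder
  set rem : ℕ → ℕ → ℝ := fun j k => U ((p j).pt (k + 1)) - U ((p j).pt k) -
    heatD F (τ ((p j).pt k)) (Z ((p j).pt k)) * (Real.exp (Z ((p j).pt (k + 1)) - Z ((p j).pt k) -
      (q ((p j).pt (k + 1)) - q ((p j).pt k)) / 2) - 1) - h ((p j).pt k) * a j k with hrem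
  have hrem0 : Tendsto (fun j =>
      ∑ k ∈ (Finset.range (p j).n).filter (fun k => (p j).pt (k + 1) ≤ t), rem j k) atTop
      (𝓝 0) := by
    refine tendsto_of_forall_eventually_abs_sub_le
      (2 * (q t + 1) + q t + (2 + 3 * |M|) * (eVariationOn b (Icc 0 T)).toReal) fun ε hε => ?_
    obtain ⟨η, hη, hloc⟩ := hF.exists_abs_heat_increment_sub_le R hτt hε
    -- η/2 is for the logarithmic price, whose increment is a sum of two; `ε` makes the cross terms
    -- small; 1 gives |Δb|² ≤ |Δb|.
    set ρ := min (min (η / 2) ε) 1 with hρ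
    have hρ0 : 0 < ρ := by positivity
    have hρη : ρ ≤ η / 2 := (min_le_left _ _).trans (min_le_left _ _)
    have hρε : ρ ≤ ε := (min_le_left _ _).trans (min_le_right _ _)
    have hρ1 : ρ ≤ 1 := min_le_right _ _
    have uc : ∀ g : ℝ → ℝ, ContinuousOn g (Icc 0 T) → ∀ᶠ j in atTop, ∀ k < (p j).n,
        |g ((p j).pt (k + 1)) - g ((p j).pt k)| < ρ := by
      intro g hg
      have := isCompact_Icc.uniformContinuousOn_of_continuous hg
      rw [Metric.uniformContinuousOn_iff] at this
      obtain ⟨δ, hδ, hδρ⟩ := this ρ hρ0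
      filter_upwards [hp δ hδ] with j hj k hk
      have h1 := (p j).pt_lt k hk
      have := hδρ _ ((p j).pt_mem hk) _ ((p j).pt_mem hk.le) (by
        rw [Real.dist_eq, abs_of_pos (by linarith)]
        exact hj k hk)
      rwa [Real.dist_eq] at this
    filter_upwards [uc x hx, uc b hb, uc q hqc, hbounds] with j hjx hjb hjq hjB
    rw [sub_zero]
    set s := (Finset.range (p j).n).filter (fun k => (p j).pt (k + 1) ≤ t) with hs
    have hterm : ∀ k ∈ s, |rem j k| ≤
        ε * (2 * (x ((p j).pt (k + 1)) - x ((p j).pt k)) ^ 2 +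
          (q ((p j).pt (k + 1)) - q ((p j).pt k)) +
          (2 + 3 * |M|) * |b ((p j).pt (k + 1)) - b ((p j).pt k)|) := by
      intro k hk
      rw [hs, Finset.mem_filter, Finset.mem_range] at hk
      have hlt := (p j).pt_lt k hk.1
      have hmem1 : (p j).pt (k + 1) ∈ Icc 0 t := ⟨((p j).pt_mem hk.1).1, hk.2⟩
      have hmem0 : (p j).pt k ∈ Icc 0 t := ⟨((p j).pt_mem hk.1.le).1, by linarith [hk.2]⟩
      set r := (p j).pt k with hr
      set r' := (p j).pt (k + 1) with hr'
      have hdx := hjx k hk.1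
      have hdb := hjb k hk.1
      have hdq := hjq k hk.1
      have hq0' := hqnn j k hk.1
      rw [← hr, ← hr'] at hdx hdb hdq hq0'
      have hττ : τ r - τ r' = q r' - q r := by simp only [hτ]; ring
      have hdZ : Z r' - Z r = (b r' - b r) + (x r' - x r) := by simp only [hZ]; ring
      have hdZabs : |Z r' - Z r| < η := by
        rw [hdZ]
        exact (abs_add_le _ _).trans_lt (by linarith)
      have h1 := hloc (τ r) (hτmem r hmem0) (τ r') (hτmem r' hmem1)
        (by linarith) (Z r) (abs_le.1 (hR r hmem0)) (Z r') (abs_le.1 (hR r' hmem1)) hdZabs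
        (by rw [hττ]; rw [abs_of_nonneg hq0'] at hdq; linarith)
      rw [hττ] at h1
      have hsqs : |b r' - b r| ^ 2 ≤ |b r' - b r| := by
        rw [sq]
        exact mul_le_of_le_one_left (abs_nonneg _) (hdb.le.trans hρ1)
      have hZsq : (Z r' - Z r) ^ 2 ≤ 2 * (x r' - x r) ^ 2 + 2 * |b r' - b r| := by
        rw [hdZ]
        rw [sq_abs] at hsqs
        nlinarith [sq_nonneg ((b r' - b r) - (x r' - x r))]
      -- Trading (ΔZ)² for (Δx)² costs (Δb + 2Δx)Δb, at most 3ε|Δb|, which is summable by bounded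
      -- variation.
      have hcross : |h r * ((Z r' - Z r) ^ 2 - (x r' - x r) ^ 2)| ≤
          |M| * (3 * ε * |b r' - b r|) := by
        rw [abs_mul]
        refine mul_le_mul ((hM r hmem0).trans (le_abs_self M)) ?_ (abs_nonneg _) (abs_nonneg _)
        rw [hdZ, show (b r' - b r + (x r' - x r)) ^ 2 - (x r' - x r) ^ 2 =
          ((b r' - b r) + 2 * (x r' - x r)) * (b r' - b r) by ring, abs_mul]
        gcongr
        refine (abs_add_le _ _).trans ?_
        rw [abs_mul, abs_two]
        linarith
      have hdecomp : rem j k = (heat F (τ r') (Z r') - heat F (τ r) (Z r) -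
          heatD F (τ r) (Z r) * (Real.exp (Z r' - Z r - (q r' - q r) / 2) - 1) -
          (heatDD F (τ r) (Z r) - heatD F (τ r) (Z r)) / 2 *
            ((Z r' - Z r) ^ 2 - (q r' - q r))) +
          h r * ((Z r' - Z r) ^ 2 - (x r' - x r) ^ 2) := by
        simp only [hrem, ha, hU, hh]
        ring
      rw [hdecomp]
      refine (abs_add_le _ _).trans ?_
      have h2 : ε * ((Z r' - Z r) ^ 2 + (q r' - q r)) ≤
          ε * (2 * (x r' - x r) ^ 2 + 2 * |b r' - b r| + (q r' - q r)) := by gcongr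
      linarith
    have hbsum : ∑ k ∈ s, |b ((p j).pt (k + 1)) - b ((p j).pt k)| ≤
        (eVariationOn b (Icc 0 T)).toReal := by
      obtain ⟨N, hN, hNe, -, -⟩ := (p j).exists_filter_eq_range ht.1
      rw [hs, hNe]
      exact (p j).sum_abs_sub_le hb' hN
    have hxsum : ∑ k ∈ s, (x ((p j).pt (k + 1)) - x ((p j).pt k)) ^ 2 ≤ q t + 1 := hjB
    calc |∑ k ∈ s, rem j k| ≤ ∑ k ∈ s, |rem j k| := Finset.abs_sum_le_sum_abs _ _
      _ ≤ _ := Finset.sum_le_sum hterm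
      _ = ε * (2 * (∑ k ∈ s, (x ((p j).pt (k + 1)) - x ((p j).pt k)) ^ 2) +
          (∑ k ∈ s, (q ((p j).pt (k + 1)) - q ((p j).pt k))) +
          (2 + 3 * |M|) * ∑ k ∈ s, |b ((p j).pt (k + 1)) - b ((p j).pt k)|) := by
          simp only [← Finset.mul_sum, Finset.sum_add_distrib]
      _ ≤ ε * (2 * (q t + 1) + q t + (2 + 3 * |M|) * (eVariationOn b (Icc 0 T)).toReal) := by
          gcongr
          exact hqsum j
      _ = _ := mul_comm _ _
  have hfinal := (htele.sub hrem0).sub hweak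
  rw [sub_zero, sub_zero] at hfinal
  refine hfinal.congr fun j => ?_
  rw [← Finset.sum_sub_distrib, ← Finset.sum_sub_distrib]
  refine Finset.sum_congr rfl fun k _ => ?_
  simp only [hrem]
  ring

/-! ### From convergence in probability to pathwise convergence -/

section Subsequences

variable {Ω : Type*} [MeasurableSpace Ω] {P : Measure Ω}

/-- Countably many sequences converging in measure have a common subsequence along which all of
them converge almost everywhere. -/
theorem exists_seq_forall_tendsto_ae {f : ℕ → ℕ → Ω → ℝ} {g : ℕ → Ω → ℝ}
    (h : ∀ i, TendstoInMeasure P (f i) atTop (g i)) :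
    ∃ ns : ℕ → ℕ, StrictMono ns ∧
      ∀ᵐ ω ∂P, ∀ i, Tendsto (fun n => f i (ns n) ω) atTop (𝓝 (g i ω)) := by
  -- Treating the first j + 1 sequences together at tolerance 2^(-j) replaces an iterated diagonal
  -- extraction.
  have hev : ∀ j : ℕ, ∀ᶠ n in atTop, ∀ i ≤ j,
      P {ω | (2⁻¹ : ENNReal) ^ j ≤ edist (f i n ω) (g i ω)} ≤ 2⁻¹ ^ j := by
    intro j
    have hj := (Set.finite_Iic j).eventually_all (l := atTop)
      (p := fun i n => P {ω | (2⁻¹ : ENNReal) ^ j ≤ edist (f i n ω) (g i ω)} ≤ 2⁻¹ ^ j)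
    refine hj.2 fun i _ => ?_
    have hpos : (0 : ENNReal) < 2⁻¹ ^ j := ENNReal.pow_pos (by simp) _
    exact (h i _ hpos).eventually_le_const hpos
  obtain ⟨ns, hns, hns'⟩ := extraction_forall_of_eventually hev
  refine ⟨ns, hns, ae_all_iff.2 fun i => ?_⟩
  -- Borel–Cantelli for the i-th sequence; the finitely many indices j < i, where nothing is known,
  -- are set to ∅.
  have hsum : ∑' j, P (if i ≤ j then {ω | (2⁻¹ : ENNReal) ^ j ≤ edist (f i (ns j) ω) (g i ω)}
      else ∅) ≠ ⊤ := by
    refine ne_top_of_le_ne_top (b := ∑' j : ℕ, (2⁻¹ : ENNReal) ^ j) ?_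
      (ENNReal.tsum_le_tsum fun j => ?_)
    · rw [ENNReal.tsum_geometric, ENNReal.one_sub_inv_two, inv_inv]
      exact ENNReal.ofNat_ne_top
    · split_ifs with hij
      · exact hns' j i hij
      · simp
  filter_upwards [ae_eventually_notMem hsum] with ω hω
  rw [tendsto_iff_edist_tendsto_0]
  refine tendsto_of_tendsto_of_tendsto_of_le_of_le' tendsto_const_nhds
    (ENNReal.tendsto_pow_atTop_nhds_zero_of_lt_one (r := 2⁻¹) (by simp))
    (Eventually.of_forall fun _ => zero_le) ?_
  filter_upwards [hω, eventually_ge_atTop i] with j hj hij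
  rw [if_pos hij] at hj
  exact (not_le.1 hj).le

end Subsequences

theorem qvSum_mono {T : ℝ} (p : TimePartition T) (x : ℝ → ℝ) : Monotone (qvSum p x) := by
  intro s t hst
  refine Finset.sum_le_sum_of_subset_of_nonneg ?_ fun _ _ _ => sq_nonneg _
  exact Finset.monotone_filter_right _ fun k _ hk => le_trans hk hst

/-- Pathwise quadratic variation only has to be checked at the times `max 0 (min T r)`, `r ∈ ℚ`. -/
theorem hasPathwiseQuadraticVariation_of_rat {T : ℝ} {p : ℕ → TimePartition T} {x q : ℝ → ℝ}
    (hq : ContinuousOn q (Icc 0 T))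
    (h : ∀ r : ℚ, Tendsto (fun j => qvSum (p j) x (max 0 (min T r))) atTop
      (𝓝 (q (max 0 (min T r))))) : HasPathwiseQuadraticVariation p x q := by
  intro t ht
  have hqt := hq t ht
  rw [Metric.continuousWithinAt_iff] at hqt
  refine Metric.tendsto_nhds.2 fun ε hε => ?_
  obtain ⟨δ, hδ, hδε⟩ := hqt (ε / 2) (by positivity)
  -- The sums are monotone in time, so the values at rational times on either side sandwich the one
  -- at `t`, and continuity of `q` closes the gap.
  obtain ⟨r₁, h1, h1'⟩ := exists_rat_btwn (show t - δ < t by linarith)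
  obtain ⟨r₂, h2, h2'⟩ := exists_rat_btwn (show t < t + δ by linarith)
  have hT : 0 ≤ T := ht.1.trans ht.2
  have m1 : max 0 (min T (r₁ : ℝ)) ∈ Icc 0 T := ⟨le_max_left _ _, max_le hT (min_le_left _ _)⟩
  have m2 : max 0 (min T (r₂ : ℝ)) ∈ Icc 0 T := ⟨le_max_left _ _, max_le hT (min_le_left _ _)⟩
  have a1 : max 0 (min T (r₁ : ℝ)) ≤ t := max_le ht.1 ((min_le_right _ _).trans h1'.le)
  have b1 : (r₁ : ℝ) ≤ max 0 (min T (r₁ : ℝ)) := by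
    rw [min_eq_right (h1'.le.trans ht.2)]; exact le_max_right _ _
  have a2 : t ≤ max 0 (min T (r₂ : ℝ)) := (le_min ht.2 h2.le).trans (le_max_right _ _)
  have b2 : max 0 (min T (r₂ : ℝ)) ≤ r₂ := max_le (ht.1.trans h2.le) (min_le_right _ _)
  have q1 := hδε m1 (by rw [Real.dist_eq, abs_lt]; constructor <;> linarith)
  have q2 := hδε m2 (by rw [Real.dist_eq, abs_lt]; constructor <;> linarith)
  filter_upwards [Metric.tendsto_nhds.1 (h r₁) (ε / 2) (by positivity),
    Metric.tendsto_nhds.1 (h r₂) (ε / 2) (by positivity)] with j e1 e2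
  have l1 := qvSum_mono (p j) x a1
  have l2 := qvSum_mono (p j) x a2
  rw [Real.dist_eq, abs_lt] at q1 q2 e1 e2 ⊢
  constructor <;> linarith [q1.1, q1.2, q2.1, q2.2, e1.1, e1.2, e2.1, e2.2]

theorem MeshTendsToZero.comp {T : ℝ} {p : ℕ → TimePartition T} (hp : MeshTendsToZero p)
    {ns : ℕ → ℕ} (hns : StrictMono ns) : MeshTendsToZero fun j => p (ns j) := fun ε hε =>
  hns.tendsto_atTop.eventually (hp ε hε)

/-- Only countably many times are needed, so one subsequence and one null set serve all t. -/
theorem HasQuadraticVariation.exists_seq_pathwise {Ω : Type*} [MeasurableSpace Ω] {P : Measure Ω}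
    {T : ℝ} (hT : 0 ≤ T) {X : ℝ → Ω → ℝ} {q : ℝ → ℝ} (h : HasQuadraticVariation P T X q)
    (hq : ContinuousOn q (Icc 0 T)) {p : ℕ → TimePartition T} (hp : MeshTendsToZero p) :
    ∃ ns : ℕ → ℕ, StrictMono ns ∧
      ∀ᵐ ω ∂P, HasPathwiseQuadraticVariation (fun j => p (ns j)) (fun s => X s ω) q := by
  obtain ⟨e, he⟩ := exists_surjective_nat ℚ
  obtain ⟨ns, hns, hns'⟩ := exists_seq_forall_tendsto_ae (P := P)
    (f := fun i j ω => qvSum (p j) (fun s => X s ω) (max 0 (min T (e i))))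
    (g := fun i _ => q (max 0 (min T (e i))))
    fun i => h p hp _ ⟨le_max_left _ _, max_le hT (min_le_left _ _)⟩
  refine ⟨ns, hns, ?_⟩
  filter_upwards [hns'] with ω hω
  refine hasPathwiseQuadraticVariation_of_rat hq fun r => ?_
  obtain ⟨i, rfl⟩ := he r
  exact hω i

/-! ### The law of the terminal price -/

/-- The logarithm is differentiable on (0, ∞), so it maps the null set of discontinuities to a null
set. -/
theorem ae_continuousAt_exp {f : ℝ → ℝ}
    (hf : ∀ᵐ x ∂(volume.restrict (Ioi (0 : ℝ))), ContinuousAt f x) :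
    ∀ᵐ y : ℝ, ContinuousAt f (Real.exp y) := by
  rw [ae_restrict_iff' measurableSet_Ioi] at hf
  have hN : volume {x | ¬(x ∈ Ioi (0 : ℝ) → ContinuousAt f x)} = 0 := hf
  have himg := addHaar_image_eq_zero_of_differentiableOn_of_addHaar_eq_zero (f := Real.log) volume
    (s := {x | ¬(x ∈ Ioi (0 : ℝ) → ContinuousAt f x)}) (fun x hx => by
      have hx' : 0 < x := by
        by_contra h
        exact hx fun h' => absurd h' h
      exact (Real.differentiableAt_log hx'.ne').differentiableWithinAt) hN
  refine measure_mono_null (fun y hy => ?_) himg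
  exact ⟨Real.exp y, fun h => hy (h (Real.exp_pos y)), Real.log_exp y⟩

namespace IsRegularInvertibleGaussianVolterra

variable {Ω : Type*} [MeasurableSpace Ω] {P : Measure Ω} {T : ℝ} {X : ℝ → Ω → ℝ}
  {K : ℝ → ℝ → ℝ} {m : StieltjesFunction ℝ}

/-- The Gaussian law is nondegenerate: Var X_T = ∫ K(T,u)² dm(u) ≥ ∫ K(u,u)² dm(u) = q²(T) > 0. -/
theorem map_terminal_absolutelyContinuous (hX : IsRegularInvertibleGaussianVolterra P T X K m)
    (hT : 0 ≤ T) (hq : 0 < qSq K m T) : P.map (X T) ≪ volume := by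
  have hTT : T ∈ Icc 0 T := ⟨hT, le_rfl⟩
  have hK := hX.kernel
  rw [(hX.hasGaussianLaw hTT).map_eq_gaussianReal]
  refine gaussianReal_absolutelyContinuous _ (Real.toNNReal_pos.2 ?_).ne'
  rw [variance_of_integral_eq_zero (hX.hasGaussianLaw hTT).aemeasurable (hX.centered T hTT)]
  refine hq.trans_le ?_
  have h1 : ∫ ω, X T ω ^ 2 ∂P = ∫ u, K T u ^ 2 ∂(m.measure.restrict (Ioc 0 T)) := by
    simp only [sq]
    exact hX.integral_mul_eq hTT hTT
  rw [h1]
  refine integral_mono_ae hK.integrable_diag (hK.integrable_sq hTT) ?_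
  filter_upwards [ae_restrict_mem measurableSet_Ioc] with u hu
  have hu' : u ∈ Icc 0 T := ⟨hu.1.le, hu.2⟩
  exact pow_le_pow_left₀ (hK.nonneg hu' hu) (hK.le_terminal hu' hu) 2

theorem ae_continuousAt_exp_terminal (hX : IsRegularInvertibleGaussianVolterra P T X K m)
    (hT : 0 ≤ T) (hq : 0 < qSq K m T) {f : ℝ → ℝ}
    (hf : ∀ᵐ x ∂(volume.restrict (Ioi (0 : ℝ))), ContinuousAt f x) (c : ℝ) :
    ∀ᵐ ω ∂P, ContinuousAt f (Real.exp (c + X T ω)) := by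
  have h1 : ∀ᵐ y : ℝ, ContinuousAt f (Real.exp (c + y)) :=
    (measurePreserving_add_left volume c).quasiMeasurePreserving.ae (ae_continuousAt_exp hf)
  exact ae_of_ae_map (hX.hasGaussianLaw ⟨hT, le_rfl⟩).aemeasurable
    ((hX.map_terminal_absolutelyContinuous hT hq).ae_le h1)

end IsRegularInvertibleGaussianVolterra

/-! ### The value process -/

section ValueProcess

variable {Ω : Type*} {T : ℝ} {X : ℝ → Ω → ℝ} {K : ℝ → ℝ → ℝ} {m : StieltjesFunction ℝ}
  {b f : ℝ → ℝ} {s₀ : ℝ}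

theorem assetPrice_pos (hs₀ : 0 < s₀) (t : ℝ) (ω : Ω) : 0 < assetPrice s₀ b X K m t ω :=
  mul_pos hs₀ (Real.exp_pos _)

/-- The correction -q²(t)/2 in the price and the shift -q²(t,T)/2 in the value add up to a constant,
so q² no longer enters the space variable. -/
theorem log_assetPrice_sub (hs₀ : 0 < s₀) (t : ℝ) (ω : Ω) :
    Real.log (assetPrice s₀ b X K m t ω) - qSqBetween K m t T / 2 =
      Real.log s₀ - b 0 - qSq K m T / 2 + b t + X t ω := by
  rw [assetPrice, Real.log_mul hs₀.ne' (Real.exp_pos _).ne', Real.log_exp, qSqBetween]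
  ring

theorem qSqBetween_mem_Ioc (hq : StrictMonoOn (qSq K m) (Icc 0 T)) {t : ℝ} (ht : t ∈ Ico 0 T) :
    qSqBetween K m t T ∈ Ioc 0 (qSqBetween K m 0 T) := by
  have hT : 0 ≤ T := ht.1.trans ht.2.le
  exact ⟨sub_pos.2 (hq ⟨ht.1, ht.2.le⟩ ⟨hT, le_rfl⟩ ht.2),
    sub_le_sub_left (hq.monotoneOn ⟨le_rfl, hT⟩ ⟨ht.1, ht.2.le⟩ ht.1) _⟩

theorem value_assetPrice (hq : StrictMonoOn (qSq K m) (Icc 0 T)) (hs₀ : 0 < s₀) {t : ℝ}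
    (ht : t ∈ Ico 0 T) (ω : Ω) :
    value T K m f t (assetPrice s₀ b X K m t ω) = heat (fun w => f (Real.exp w))
      (qSq K m T - qSq K m t) (Real.log s₀ - b 0 - qSq K m T / 2 + b t + X t ω) := by
  rw [value_eq_heat (qSqBetween_mem_Ioc hq ht).1 (assetPrice_pos hs₀ t ω), log_assetPrice_sub hs₀,
    qSqBetween]

/-- The pathwise change of variables formula for the delta hedge. -/
theorem tendsto_forwardSum_delta (hq : StrictMonoOn (qSq K m) (Icc 0 T))
    (hqc : ContinuousOn (qSq K m) (Icc 0 T))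
    (hF : GaussIntegrable (fun w => f (Real.exp w)) (qSqBetween K m 0 T)) (hs₀ : 0 < s₀)
    (hb : ContinuousOn b (Icc 0 T)) (hb' : BoundedVariationOn b (Icc 0 T)) {ω : Ω}
    (hX : ContinuousOn (fun s => X s ω) (Icc 0 T)) {p : ℕ → TimePartition T}
    (hp : MeshTendsToZero p)
    (hqv : HasPathwiseQuadraticVariation p (fun s => X s ω) (qSq K m)) {t : ℝ} (ht : t ∈ Ico 0 T) :
    Tendsto (fun j => forwardSum (p j)
        (fun s => delta T K m f s (assetPrice s₀ b X K m s ω))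
        (fun s => assetPrice s₀ b X K m s ω) t) atTop
      (𝓝 (value T K m f t (assetPrice s₀ b X K m t ω)
        - value T K m f 0 (assetPrice s₀ b X K m 0 ω))) := by
  have h := tendsto_sum_heatD (Real.log s₀ - b 0 - qSq K m T / 2) hq hqc hF hX hb hb' hp hqv ht
  rw [value_assetPrice hq hs₀ ht, value_assetPrice hq hs₀ ⟨le_rfl, ht.1.trans_lt ht.2⟩]
  refine h.congr fun j => Finset.sum_congr rfl fun k hk => ?_
  rw [Finset.mem_filter, Finset.mem_range] at hk
  have hlt := (p j).pt_lt k hk.1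
  have hk0 : (p j).pt k ∈ Ico 0 T := ⟨((p j).pt_mem hk.1.le).1, by linarith [hk.2, ht.2]⟩
  have hS := assetPrice_pos (b := b) (X := X) (K := K) (m := m) hs₀ ((p j).pt k) ω
  simp only
  -- The factor 1/S in the delta turns the price increment into a relative one, exp(Δb + ΔX - Δq²/2)
  -- - 1.
  rw [delta_eq_heatD hF (qSqBetween_mem_Ioc hq hk0) hS, log_assetPrice_sub hs₀, div_mul_eq_mul_div,
    mul_div_assoc, sub_div (assetPrice s₀ b X K m ((p j).pt (k + 1)) ω), div_self hS.ne', qSqBetween]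
  congr 2
  rw [assetPrice, assetPrice, mul_div_mul_left _ _ hs₀.ne', ← Real.exp_sub]
  congr 1
  ring

end ValueProcess

end GaussianHedging

/-! ### The replication theorem -/

open GaussianHedging in
theorem proposition3p1 {Ω : Type*} [MeasurableSpace Ω] (P : Measure Ω) [IsProbabilityMeasure P]
    (T : ℝ) (hT : 0 < T)
    -- the noise
    (X : ℝ → Ω → ℝ) (K : ℝ → ℝ → ℝ) (m : StieltjesFunction ℝ)
    (hX : IsRegularInvertibleGaussianVolterra P T X K m)
    -- the quadratic variation does not vanish on any interval
    (hq : StrictMonoOn (qSq K m) (Icc 0 T))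
    -- the excess return and the initial price
    (b : ℝ → ℝ) (hb : ContinuousOn b (Icc 0 T)) (hb' : BoundedVariationOn b (Icc 0 T))
    (s₀ : ℝ) (hs₀ : 0 < s₀)
    -- the payoff: almost everywhere continuous and with a well-defined value `v(0,x)`
    (f : ℝ → ℝ) (hf : ∀ᵐ x ∂(volume.restrict (Ioi (0 : ℝ))), ContinuousAt f x)
    (hfint : ∀ x > 0, Integrable (valueIntegrand T K m f 0 x)) :
    -- `q²` is the quadratic variation of `X`
    HasQuadraticVariation P T X (qSq K m) ∧
    -- `v` is well defined, and so is the delta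
    (∀ t ∈ Icc 0 T, ∀ x > 0, Integrable (valueIntegrand T K m f t x)) ∧
    (∀ t ∈ Ico 0 T, ∀ x > 0, DifferentiableAt ℝ (fun y => value T K m f t y) x) ∧
    -- the delta-hedge replicates `f(S_T)`, with value `v(t, S_t)`
    IsMarkovianReplication P T (assetPrice s₀ b X K m) (delta T K m f)
      (fun t ω => value T K m f t (assetPrice s₀ b X K m t ω))
      (fun ω => f (assetPrice s₀ b X K m T ω)) ∧
    -- and the stochastic integral is also a pathwise one, along all sequences of partitions along
    -- which the path of `X` has the quadratic variation `q²`
    (∀ᵐ ω ∂P, ∀ p : ℕ → TimePartition T, MeshTendsToZero p →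
      HasPathwiseQuadraticVariation p (fun s => X s ω) (qSq K m) →
      ∀ t ∈ Ico 0 T, Tendsto (fun j => forwardSum (p j)
        (fun s => delta T K m f s (assetPrice s₀ b X K m s ω))
        (fun s => assetPrice s₀ b X K m s ω) t) atTop
        (𝓝 (value T K m f t (assetPrice s₀ b X K m t ω)
          - value T K m f 0 (assetPrice s₀ b X K m 0 ω)))) := by
  have hqc : ContinuousOn (qSq K m) (Icc 0 T) := hX.kernel.continuousOn_qSq
  have hqv := hX.hasQuadraticVariation
  have h0 : (0 : ℝ) ∈ Ico 0 T := ⟨le_rfl, hT⟩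
  have hQ := (qSqBetween_mem_Ioc hq h0).1
  have hF := gaussIntegrable_payoff hQ hfint
  have hpath : ∀ᵐ ω ∂P, ∀ p : ℕ → TimePartition T, MeshTendsToZero p →
      HasPathwiseQuadraticVariation p (fun s => X s ω) (qSq K m) →
      ∀ t ∈ Ico 0 T, Tendsto (fun j => forwardSum (p j)
        (fun s => delta T K m f s (assetPrice s₀ b X K m s ω))
        (fun s => assetPrice s₀ b X K m s ω) t) atTop
        (𝓝 (value T K m f t (assetPrice s₀ b X K m t ω)
          - value T K m f 0 (assetPrice s₀ b X K m 0 ω))) := by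
    filter_upwards [hX.continuous] with ω hω p hp hpq t ht
    exact tendsto_forwardSum_delta hq hqc hF hs₀ hb hb' hω hp hpq ht
  have hSmeas : ∀ t ∈ Icc 0 T, AEMeasurable (assetPrice s₀ b X K m t) P := fun t ht => by
    have := (hX.hasGaussianLaw ht).aemeasurable
    unfold assetPrice
    fun_prop
  refine ⟨hqv, fun t ht x hx => ?_, fun t ht x hx => ?_, ⟨?_, ?_, ⟨?_, ?_⟩, ?_⟩, hpath⟩
  · rcases ht.2.lt_or_eq with h | rfl
    · exact integrable_valueIntegrand hF (qSqBetween_mem_Ioc hq ⟨ht.1, h⟩) hx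
    · exact integrable_valueIntegrand_terminal x
  · exact (hasDerivAt_value hF (qSqBetween_mem_Ioc hq ht) hx).differentiableAt
  · exact fun t _ => measurable_deriv _
  · refine ⟨value T K m f 0 (s₀ * Real.exp (b 0 - b 0 - qSq K m 0 / 2 + 0)), ?_⟩
    filter_upwards [hX.start] with ω hω
    rw [assetPrice, hω]
  · intro p hp t ht
    -- Convergence in probability is equivalent to almost sure convergence along a further
    -- subsequence of every subsequence, where the pathwise formula applies.
    rw [exists_seq_tendstoInMeasure_atTop_iff]
    · intro ns hns
      obtain ⟨ns', hns', hae⟩ := hqv.exists_seq_pathwise hT.le hqc (hp.comp hns)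
      refine ⟨ns', hns', ?_⟩
      filter_upwards [hae, hpath] with ω h1 h2
      exact h2 _ ((hp.comp hns).comp hns') h1 t ht
    · intro j
      refine (Finset.aemeasurable_fun_sum _ fun k hk => ?_).aestronglyMeasurable
      rw [Finset.mem_filter, Finset.mem_range] at hk
      have m0 := hSmeas _ ((p j).pt_mem hk.1.le)
      exact ((measurable_deriv _).comp_aemeasurable m0).mul ((hSmeas _ ((p j).pt_mem hk.1)).sub m0)
  · have hTT : T ∈ Icc 0 T := ⟨hT.le, le_rfl⟩
    have hqT : 0 < qSq K m T := by
      have : qSq K m 0 = 0 := by simp [qSq]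
      have h2 : 0 < qSq K m T - qSq K m 0 := hQ
      linarith
    set c := Real.log s₀ - b 0 - qSq K m T / 2 with hc
    filter_upwards [hX.continuous, hX.ae_continuousAt_exp_terminal hT.le hqT hf (c + b T)]
      with ω hω hcont
    refine Tendsto.sub_const ?_ _
    have hFc : ContinuousAt (fun w => f (Real.exp w)) (c + b T + X T ω) :=
      ContinuousAt.comp (f := Real.exp) hcont Real.continuous_exp.continuousAt
    have hle : 𝓝[<] T ≤ 𝓝[Icc 0 T] T := by
      rw [← nhdsWithin_Ioo_eq_nhdsLT hT]
      exact nhdsWithin_mono _ Ioo_subset_Icc_self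
    have hZ : Tendsto (fun t => c + b t + X t ω) (𝓝[<] T) (𝓝 (c + b T + X T ω)) :=
      (((continuousOn_const.add hb).add hω) T hTT).tendsto.mono_left hle
    have hmem : ∀ᶠ t in 𝓝[<] T, t ∈ Ico 0 T := by
      rw [← nhdsWithin_Ioo_eq_nhdsLT hT]
      filter_upwards [self_mem_nhdsWithin] with t ht using ⟨ht.1.le, ht.2⟩
    have hτ : Tendsto (fun t => qSq K m T - qSq K m t) (𝓝[<] T) (𝓝[>] 0) := by
      refine tendsto_nhdsWithin_iff.2 ⟨?_, ?_⟩
      · have := ((continuousOn_const.sub hqc) T hTT : ContinuousWithinAt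
          (fun t => qSq K m T - qSq K m t) (Icc 0 T) T).tendsto.mono_left hle
        rw [Pi.sub_apply, sub_self] at this
        exact this
      · filter_upwards [hmem] with t ht using (qSqBetween_mem_Ioc hq ht).1
    have hterm : value T K m f T (assetPrice s₀ b X K m T ω) = f (Real.exp (c + b T + X T ω)) := by
      rw [value_terminal, hc, ← log_assetPrice_sub (T := T) hs₀, qSqBetween, sub_self, zero_div,
        sub_zero, Real.exp_log (assetPrice_pos hs₀ T ω)]
    rw [hterm]
    -- The remaining variance and the space variable move simultaneously, hence the need for joint
    -- convergence of `heat`.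
    refine ((hF.tendsto_heat hQ hFc).comp (hτ.prodMk hZ)).congr' ?_
    filter_upwards [hmem] with t ht
    exact (value_assetPrice hq hs₀ ht ω).symm
  · exact Eventually.of_forall fun ω => value_terminal _
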